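/- All rings are commutative with identity. An ideal $I$ of a ring $R$ is *stable* if it is projective as a module over its endomorphism ring $\mathrm{End}_R(I)$, and an integral domain is *stable* if each of its nonzero ideals is stable. A *bad stable domain* is a quasilocal (i.e. having a unique maximal ideal, not necessarily Noetherian) stable domain of Krull dimension $1$ whose integral closure in its quotient field is not a finitely generated module over it. The *embedding dimension* of a quasilocal ring is the least cardinality of a generating set of its maximal ideal. Let $R$ be a bad stable domain with quotient field $F$, let $\overline{R}$ be the integral closure of $R$ in $F$, and let $n$ be the (possibly infinite) embedding dimension of $R$. Then $n$ is finite if and only if $R$ is Noetherian, and the following hold. (1) If $n$ is finite, then every ring $S$ with $R \subseteq S \subsetneq \overline{R}$ is a bad stable domain that is Noetherian and has embedding dimension at most $n$. (2) For every integer $k$ with $2 \le k \le n$, there is a Noetherian bad stable domain $S$ of embedding dimension $k$ with $R \subseteq S \subseteq \overline{R}$ such that $S/R$ is isomorphic, as an $R$-module, to a direct sum of (possibly zero, possibly infinitely many) copies of $F/\overline{R}$. -/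

import Mathlib

universe u v

open scoped DirectSum Cardinal

/-- An ideal is stable if it is projective as a module over its ring of endomorphisms
(which acts on it by evaluation). -/
def IsStableIdeal {R : Type u} [CommRing R] (I : Ideal R) : Prop :=
  Module.Projective (Module.End R I) I

/-- A stable domain: an integral domain all of whose nonzero ideals are stable. -/
class IsStableDomain (R : Type u) [CommRing R] : Prop extends IsDomain R where
  stable : ∀ I : Ideal R, I ≠ ⊥ → IsStableIdeal I

/-- A domain has finite normalization if its integral closure in its quotient field is a
finitely generated module over it. -/
def HasFiniteNormalization (R : Type u) [CommRing R] [IsDomain R] : Prop :=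
  Module.Finite R (integralClosure R (FractionRing R))

/-- A bad stable domain: a quasilocal stable domain (not necessarily Noetherian) of Krull
dimension one that does not have finite normalization. -/
class IsBadStableDomain (R : Type u) [CommRing R] : Prop extends
    IsStableDomain R, IsLocalRing R where
  krullDim_eq_one : ringKrullDim R = 1
  not_finite : ¬ HasFiniteNormalization R

/-- The embedding dimension of a quasilocal ring: the least cardinality of a generating set of
its maximal ideal. It may be infinite. -/
noncomputable def embDim (R : Type u) [CommRing R] [IsLocalRing R] : Cardinal.{u} :=
  (IsLocalRing.maximalIdeal R).spanRank

/-- The `R`-module `F / R̄`, where `R̄` is the integral closure of `R` in `F`. -/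
abbrev QuotNormalization (R : Type u) (F : Type v) [CommRing R] [Field F] [Algebra R F] :
    Type v :=
  F ⧸ Subalgebra.toSubmodule (integralClosure R F)

/-- The `R`-module `S / R`, for an `R`-algebra `S` (`R` is identified with its image in `S`). -/
abbrev QuotBase (R : Type u) (S : Type v) [CommRing R] [CommRing S] [Algebra R S] : Type v :=
  S ⧸ LinearMap.range (Algebra.linearMap R S)

/-! Write V for the integral closure of R in F and m for the maximal ideal of R. Stability of a
nonzero ideal I means invertibility over its endomorphism ring, that is 1 ∈ I(I : I²). For a
finitely generated R-module M with 1 ∈ M ⊆ V, this and lying over make M a ring, so st ∈ R + Rs + Rt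
for all s, t ∈ V. A quadratic integral extension of a local ring is finite as soon as it is not
local or enlarges the residue field. As V is not finite, it is local; stability then makes it a
valuation ring, mV is generated by some x ∈ m, and V = R + xV. These facts, collected in
`IsTwistedDomain`, characterise bad stable domains and pass, with the same x, to every ring S with R
⊆ S ⊊ V (`IsTwistedDomain.of_subalgebra`).

The rest is read off the R-module V/R, which is x-divisible and x-power torsion. Since m = R ∩ xV
and m² = xm, division by x identifies m/xR with the socle of V/R (the elements killed by x,
equivalently by m), so the embedding dimension is one more than the dimension of the socle.

For (1), x acts nilpotently on a finitely generated submodule of V/R, so when its kernel there has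
finite length its cokernel has the same length; hence the socle of V/S is no larger than that of V/R
(`IsTwistedDomain.le_of_isSocleIndependent`). For (2), extending a basis of the socle to x-divisible
sequences gives V/R ≅ ⨁ F/V, where each summand has a one-dimensional socle. By the quadratic
relation every R-module between R and V is a ring, so omitting k - 1 summands defines S with V/S ≅
(F/V)^(k-1), of embedding dimension k, and S/R is the sum of the remaining summands. -/

section Stability

/-! ### Stable ideals and the integral closure of a stable domain -/

open Submodule

/-- Both sides are y applied to the product pq. Hence an endomorphism of a nonzero ideal of a domain
is multiplication by the fraction y(a)/a, for any nonzero a in the ideal. -/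
theorem Ideal.mul_end_apply_comm {R : Type u} [CommRing R] {I : Ideal R} (y : Module.End R I)
    (p q : I) : (q : R) * (y p : R) = p * (y q : R) := by
  have h1 : (q : R) • p = (p : R) • q := by
    ext; simp [mul_comm]
  have h2 := congrArg (fun z : I => (z : R)) (congrArg y h1)
  simpa using h2

theorem isIntegral_of_mul_mem_fg {R : Type u} {F : Type v} [CommRing R] [IsDomain R] [Field F]
    [Algebra R F] {M : Submodule R F} (hM : 1 ∈ M) (hfg : M.FG)
    {y : F} (hy : ∀ z ∈ M, y * z ∈ M) : IsIntegral R y :=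
  isIntegral_of_smul_mem_submodule M (by rintro rfl; simp at hM) hfg y hy

variable {R : Type u} {F : Type v} [CommRing R] [Field F] [Algebra R F] [IsFractionRing R F]

/-- A stable nonzero ideal is invertible over its ring of endomorphisms; here this is expressed
inside the quotient field. -/
theorem IsStableIdeal.one_mem_mul_div {I : Ideal R} (h : IsStableIdeal I) (hI : I ≠ ⊥) :
    (1 : F) ∈ map (Algebra.linearMap R F) I *
      (map (Algebra.linearMap R F) I /
        (map (Algebra.linearMap R F) I * map (Algebra.linearMap R F) I)) := by
  obtain ⟨s, hs⟩ := Module.projective_def.mp h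
  obtain ⟨a, haI, ha⟩ := Submodule.exists_mem_ne_zero_of_ne_bot hI
  have haF : algebraMap R F a ≠ 0 := fun h0 =>
    ha (IsFractionRing.injective R F (by rw [h0, map_zero]))
  set a' : I := ⟨a, haI⟩ with ha'
  have hsum : a' = ∑ p ∈ (s a').support, (s a' p) p := by
    conv_lhs => rw [← hs a']
    rw [Finsupp.linearCombination_apply, Finsupp.sum]
    rfl
  -- Linearity of the section over the endomorphism ring: scaling by b or by a turns a or b into the
  -- same element ab.
  have hlin : ∀ (b : I) (p z : I), (b : R) * (s a' p z : R) = a * (s b p z : R) := by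
    intro b p z
    have h1 : algebraMap R (Module.End R I) b • a' = algebraMap R (Module.End R I) a • b := by
      ext; simp [ha', mul_comm]
    have h2 := congrArg (fun f => ((f p) z : R)) (congrArg s h1)
    simpa using h2
  -- Dual basis: the coordinate of `s` at p, a map from I to its endomorphisms, is multiplication by
  -- s(a)_p(a)/a². These fractions therefore lie in (I : I²), and the expansion of a gives 1 = ∑ p ·
  -- s(a)_p(a)/a².
  have hone : (1 : F) = ∑ p ∈ (s a').support,
      algebraMap R F p * (algebraMap R F (s a' p a') / algebraMap R F a ^ 2) := by
    have h1 : a * a = ∑ p ∈ (s a').support, (p : R) * (s a' p a' : R) := by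
      conv_lhs => rw [show a = ((∑ p ∈ (s a').support, (s a' p) p : I) : R) from
        congrArg Subtype.val hsum]
      rw [AddSubmonoidClass.coe_finsetSum]
      rw [Finset.sum_mul]
      refine Finset.sum_congr rfl fun p _ => ?_
      have h3 := Ideal.mul_end_apply_comm (s a' p) p a'
      have h4 : (a' : R) = ∑ p ∈ (s a').support, ((s a' p) p : R) := by
        conv_lhs => rw [hsum]
        rw [AddSubmonoidClass.coe_finsetSum]
      rw [← h4, mul_comm, h3]
    have h2 := congrArg (algebraMap R F) h1
    simp only [map_mul, map_sum] at h2
    simp only [← mul_div_assoc, ← Finset.sum_div]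
    rw [← h2, pow_two, div_self (mul_ne_zero haF haF)]
  rw [hone]
  refine Submodule.sum_mem _ fun p _ => Submodule.mul_mem_mul ⟨p, p.2, rfl⟩ ?_
  rw [Submodule.mem_div_iff_forall_mul_mem]
  intro y hy
  induction hy using Submodule.mul_induction_on' with
  | mem_mul_mem b hb c hc =>
    obtain ⟨b, hb, rfl⟩ := hb
    obtain ⟨c, hc, rfl⟩ := hc
    refine ⟨s ⟨b, hb⟩ p ⟨c, hc⟩, Subtype.property _, ?_⟩
    have h1 := hlin ⟨b, hb⟩ p a'
    have h2 := Ideal.mul_end_apply_comm (s ⟨b, hb⟩ p) a' ⟨c, hc⟩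
    have h3 : (s a' p a' : R) * (b * c) = a ^ 2 * (s ⟨b, hb⟩ p ⟨c, hc⟩ : R) := by
      simp only [ha'] at h1 h2 ⊢
      linear_combination c * h1 + a * h2
    have h4 := congrArg (algebraMap R F) h3
    simp only [map_mul, map_pow] at h4
    simp only [Algebra.linearMap_apply]
    rw [div_mul_eq_mul_div, h4, mul_div_cancel_left₀ _ (pow_ne_zero 2 haF)]
  | add b _ c _ hb hc => rw [mul_add]; exact add_mem hb hc

/-- The same for fractional ideals of a stable domain. -/
theorem IsStableDomain.one_mem_mul_div [IsStableDomain R] {M : Submodule R F} (hM : 1 ∈ M)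
    {d : R} (hd : d ≠ 0) (hdM : ∀ y ∈ M, ∃ r : R, algebraMap R F d * y = algebraMap R F r) :
    (1 : F) ∈ M * (M / (M * M)) := by
  have hdF : algebraMap R F d ≠ 0 := fun h0 =>
    hd (IsFractionRing.injective R F (by rw [h0, map_zero]))
  let f : F →ₗ[R] F := LinearMap.mulLeft R (algebraMap R F d)
  let I : Ideal R := comap (Algebra.linearMap R F) (map f M)
  have hmap : map (Algebra.linearMap R F) I = map f M := by
    refine Submodule.map_comap_eq_of_le ?_
    rintro _ ⟨y, hy, rfl⟩
    obtain ⟨r, hr⟩ := hdM y hy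
    exact ⟨r, hr.symm⟩
  have hI : I ≠ ⊥ := by
    refine (Submodule.ne_bot_iff _).mpr ⟨d, ⟨1, hM, ?_⟩, hd⟩
    simp [f]
  have h := (IsStableDomain.stable I hI).one_mem_mul_div (F := F) hI
  rw [hmap] at h
  -- The factors d cancel: (dM : d²M²) = d⁻¹(M : M²).
  have key : map f M * (map f M / (map f M * map f M)) ≤ M * (M / (M * M)) := by
    rw [Submodule.mul_le]
    rintro _ ⟨p, hp, rfl⟩ n hn
    have : f p * n = p * (algebraMap R F d * n) := by simp [f]; ring
    rw [this]
    refine Submodule.mul_mem_mul hp ?_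
    rw [Submodule.mem_div_iff_forall_mul_mem] at hn ⊢
    intro y hy
    have h1 : f (f y) ∈ map f M * map f M := by
      have : map f M * map f M = map (f ∘ₗ f) (M * M) := by
        apply le_antisymm
        · rw [Submodule.mul_le]
          rintro _ ⟨p, hp, rfl⟩ _ ⟨q, hq, rfl⟩
          exact ⟨p * q, Submodule.mul_mem_mul hp hq, by simp [f]; ring⟩
        · rintro _ ⟨z, hz, rfl⟩
          induction hz using Submodule.mul_induction_on' with
          | mem_mul_mem b hb c hc =>
            have : (f ∘ₗ f) (b * c) = f b * f c := by simp [f]; ring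
            rw [this]
            exact Submodule.mul_mem_mul ⟨b, hb, rfl⟩ ⟨c, hc, rfl⟩
          | add b _ c _ hb hc => rw [map_add]; exact add_mem hb hc
      rw [this]
      exact ⟨y, hy, rfl⟩
    obtain ⟨z, hz, hz'⟩ := hn _ h1
    have : algebraMap R F d * n * y = z := by
      apply mul_left_cancel₀ hdF
      simp only [f, LinearMap.mulLeft_apply] at hz'
      rw [hz']; ring
    rw [this]; exact hz
  exact key h

/-- Finitely generated submodules of the quotient field have common denominators. -/
theorem exists_common_denominator {M : Submodule R F} (hM : M.FG) [IsDomain R] :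
    ∃ d : R, d ≠ 0 ∧ ∀ y ∈ M, ∃ r : R, algebraMap R F d * y = algebraMap R F r := by
  obtain ⟨s, rfl⟩ := hM
  obtain ⟨d, hd⟩ := IsLocalization.exist_integer_multiples_of_finset (nonZeroDivisors R) s
  refine ⟨d, nonZeroDivisors.coe_ne_zero d, fun y hy => ?_⟩
  induction hy using Submodule.span_induction with
  | mem y hy =>
    obtain ⟨r, hr⟩ := hd y hy
    exact ⟨r, by rw [hr, Algebra.smul_def]⟩
  | zero => exact ⟨0, by simp⟩
  | add y z _ _ hy hz =>
    obtain ⟨r, hr⟩ := hy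
    obtain ⟨r', hr'⟩ := hz
    exact ⟨r + r', by rw [mul_add, hr, hr', map_add]⟩
  | smul a y _ hy =>
    obtain ⟨r, hr⟩ := hy
    exact ⟨a * r, by rw [Algebra.smul_def, mul_left_comm, hr, map_mul]⟩

theorem IsStableDomain.one_mem_mul_div_of_fg [IsStableDomain R] {M : Submodule R F} (hM : 1 ∈ M)
    (hfg : M.FG) : (1 : F) ∈ M * (M / (M * M)) := by
  obtain ⟨d, hd, hdM⟩ := exists_common_denominator hfg
  exact IsStableDomain.one_mem_mul_div hM hd hdM

/-- A finitely generated module between a stable domain and its integral closure is a ring. -/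
theorem IsStableDomain.mul_mem_of_fg [IsStableDomain R] {M : Submodule R F} (hM : 1 ∈ M)
    (hfg : M.FG) (hint : ∀ y ∈ M, IsIntegral R y) {b c : F} (hb : b ∈ M) (hc : c ∈ M) :
    b * c ∈ M := by
  have h1 := IsStableDomain.one_mem_mul_div_of_fg hM hfg
  set N := M / (M * M) with hN
  have hNmul : ∀ n ∈ N, ∀ b ∈ M, ∀ c ∈ M, n * (b * c) ∈ M := fun n hn b hb c hc =>
    (Submodule.mem_div_iff_forall_mul_mem.mp hn) _ (Submodule.mul_mem_mul hb hc)
  have hNM : ∀ n ∈ N, ∀ b ∈ M, n * b ∈ M := fun n hn b hb => by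
    simpa using hNmul n hn b hb 1 hM
  let E : Subalgebra R F :=
    { carrier := {e | ∀ z ∈ M, e * z ∈ M}
      mul_mem' := fun {a b} ha hb z hz => by
        rw [mul_assoc]; exact ha _ (hb _ hz)
      add_mem' := fun {a b} ha hb z hz => by
        rw [add_mul]; exact add_mem (ha _ hz) (hb _ hz)
      algebraMap_mem' := fun r z hz => by
        rw [← Algebra.smul_def]; exact M.smul_mem r hz }
  have hEV : E ≤ integralClosure R F := fun e he => isIntegral_of_mul_mem_fg hM hfg he
  -- N = (M : M²) is an ideal of the endomorphism ring E of M. As 1 ∈ MN with M integral, N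
  -- generates the unit ideal of V; lying over for E ⊆ V then forces 1 ∈ N, which says M² ⊆ M.
  let J : Ideal E :=
    { carrier := {e | (e : F) ∈ N}
      add_mem' := fun ha hb => N.add_mem ha hb
      zero_mem' := N.zero_mem
      smul_mem' := fun e n hn => by
        change (e : F) * n ∈ N
        rw [hN, Submodule.mem_div_iff_forall_mul_mem]
        intro z hz
        rw [mul_assoc]
        exact e.2 _ (Submodule.mem_div_iff_forall_mul_mem.mp hn z hz) }
  let φ : E →+* integralClosure R F := (Subalgebra.inclusion hEV).toRingHom
  have hφ : φ.IsIntegral := by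
    intro y
    have h2 : IsIntegral E (y : F) := IsIntegral.tower_top y.2
    obtain ⟨p, hp, hp'⟩ := h2
    refine ⟨p, hp, Subtype.val_injective ?_⟩
    rw [← Subalgebra.coe_val, ← RingHom.coe_coe, Polynomial.hom_eval₂, map_zero]
    exact hp'
  have hmap : J.map φ = ⊤ := by
    rw [Ideal.eq_top_iff_one]
    have h3 : ∀ z ∈ M * N, ∃ w ∈ J.map φ, (w : F) = z := by
      intro z hz
      induction hz using Submodule.mul_induction_on' with
      | mem_mul_mem p hp n hn =>
        have hnE : n ∈ E := fun z hz => hNM n hn z hz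
        refine ⟨⟨p, hint p hp⟩ * φ ⟨n, hnE⟩, Ideal.mul_mem_left _ _
          (Ideal.mem_map_of_mem _ (show (⟨n, hnE⟩ : E) ∈ J from hn)), rfl⟩
      | add b _ c _ hb hc =>
        obtain ⟨w, hw, rfl⟩ := hb
        obtain ⟨w', hw', rfl⟩ := hc
        exact ⟨w + w', add_mem hw hw', rfl⟩
    obtain ⟨w, hw, hw1⟩ := h3 1 h1
    have : w = 1 := Subtype.val_injective hw1
    rwa [this] at hw
  have hJ : J = ⊤ := (Ideal.map_eq_top_iff φ (Subalgebra.inclusion_injective hEV) hφ).mp hmap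
  have h1N : (1 : F) ∈ N := (Ideal.eq_top_iff_one J).mp hJ
  simpa using hNmul 1 h1N b hb c hc

/-- The integral closure of a stable domain is a quadratic extension. -/
theorem IsStableDomain.exists_mul_eq [IsStableDomain R] {s t : F} (hs : IsIntegral R s)
    (ht : IsIntegral R t) :
    ∃ a b c : R, s * t = algebraMap R F a + algebraMap R F b * s + algebraMap R F c * t := by
  let M : Submodule R F := span R {1, s, t}
  have hint : ∀ y ∈ M, IsIntegral R y := by
    intro y hy
    have : M ≤ Subalgebra.toSubmodule (integralClosure R F) := by
      refine span_le.mpr ?_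
      rintro y (rfl | rfl | rfl)
      · exact isIntegral_one
      · exact hs
      · exact ht
    exact this hy
  have := IsStableDomain.mul_mem_of_fg (M := M) (subset_span (by simp))
    (Submodule.fg_span (by simp)) hint (b := s) (c := t) (subset_span (by simp))
    (subset_span (by simp))
  obtain ⟨a, y, hy, h1⟩ := Submodule.mem_span_insert.mp this
  obtain ⟨b, z, hz, h2⟩ := Submodule.mem_span_insert.mp hy
  obtain ⟨c, h3⟩ := Submodule.mem_span_singleton.mp hz
  refine ⟨a, b, c, ?_⟩
  rw [h1, h2, ← h3]
  simp only [Algebra.smul_def]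
  ring

/-- If the integral closure of a stable domain is local, then it is a valuation ring. -/
theorem IsStableDomain.isIntegral_or_isIntegral_inv [IsStableDomain R]
    [IsLocalRing (integralClosure R F)] (y : F) : IsIntegral R y ∨ IsIntegral R y⁻¹ := by
  by_cases hy0 : y = 0
  · left; rw [hy0]; exact isIntegral_zero
  let M : Submodule R F := span R {1, y}
  have h1M : (1 : F) ∈ M := subset_span (by simp)
  have hyM : y ∈ M := subset_span (by simp)
  have hfg : M.FG := Submodule.fg_span (by simp)
  have h1 := IsStableDomain.one_mem_mul_div_of_fg h1M hfg
  by_contra! hcon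
  have hNint : ∀ n ∈ M / (M * M), ∀ b ∈ M, IsIntegral R (n * b) := fun n hn b hb =>
    isIntegral_of_mul_mem_fg h1M hfg fun z hz => by
      rw [mul_assoc]
      exact Submodule.mem_div_iff_forall_mul_mem.mp hn _ (Submodule.mul_mem_mul hb hz)
  have hunit : ∀ w : integralClosure R F, IsUnit w → IsIntegral R (w : F)⁻¹ := by
    rintro w ⟨w, rfl⟩
    have : ((w : integralClosure R F) : F)⁻¹ = ((w⁻¹ : (integralClosure R F)ˣ) : F) := by
      have h2 := congrArg Subtype.val w.mul_inv
      exact inv_eq_of_mul_eq_one_right h2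
    rw [this]
    exact Subtype.property _
  -- For n ∈ (M : M²) both n and ny are integral. If n were a unit, y = n⁻¹(ny) would be integral;
  -- if ny were, y⁻¹ = (ny)⁻¹n would be. So the whole product, which contains 1, would consist of
  -- nonunits.
  have key : ∀ z ∈ M * (M / (M * M)), ∃ w ∈ IsLocalRing.maximalIdeal (integralClosure R F),
      (w : F) = z := by
    intro z hz
    induction hz using Submodule.mul_induction_on' with
    | mem_mul_mem p hp n hn =>
      have hn1 : IsIntegral R n := by simpa using hNint n hn 1 h1M
      have hny := hNint n hn y hyM
      have h2 : (⟨n, hn1⟩ : integralClosure R F) ∈ IsLocalRing.maximalIdeal _ := by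
        rw [IsLocalRing.mem_maximalIdeal, mem_nonunits_iff]
        intro hu
        have hn0 : n ≠ 0 := fun h0 => hu.ne_zero (Subtype.val_injective h0)
        refine hcon.1 ?_
        have h3 := (hunit _ hu).mul hny
        rwa [inv_mul_cancel_left₀ hn0] at h3
      have h3 : (⟨n * y, hny⟩ : integralClosure R F) ∈ IsLocalRing.maximalIdeal _ := by
        rw [IsLocalRing.mem_maximalIdeal, mem_nonunits_iff]
        intro hu
        have hn0 : n * y ≠ 0 := fun h0 => hu.ne_zero (Subtype.val_injective h0)
        have hn0' : n ≠ 0 := left_ne_zero_of_mul hn0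
        refine hcon.2 ?_
        have h3 := (hunit _ hu).mul hn1
        have h4 : (n * y)⁻¹ * n = y⁻¹ := by field_simp
        rwa [h4] at h3
      obtain ⟨a, b, rfl⟩ := Submodule.mem_span_pair.mp hp
      refine ⟨_, add_mem (Ideal.mul_mem_left _ (algebraMap R _ a) h2)
        (Ideal.mul_mem_left _ (algebraMap R _ b) h3), ?_⟩
      simp only [Algebra.smul_def]
      change algebraMap R F a * n + algebraMap R F b * (n * y) = _
      ring
    | add b _ c _ hb hc =>
      obtain ⟨w, hw, rfl⟩ := hb
      obtain ⟨w', hw', rfl⟩ := hc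
      exact ⟨w + w', add_mem hw hw', rfl⟩
  obtain ⟨w, hw, hw1⟩ := key 1 h1
  have : w = 1 := Subtype.val_injective hw1
  rw [this] at hw
  exact (Ideal.ne_top_iff_one _).mp (IsLocalRing.maximalIdeal.isMaximal _).ne_top hw

end Stability

/-- A quadratic algebra: every submodule containing `1` is a subring. -/
def IsQuadraticAlgebra (R : Type u) (A : Type v) [CommRing R] [CommRing A] [Algebra R A] : Prop :=
  ∀ s t : A, ∃ a b c : R, s * t = algebraMap R A a + algebraMap R A b * s + algebraMap R A c * t

/-! ### Quadratic integral extensions of a local ring: residue fields and locality -/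

section Quadratic

open IsLocalRing

section

variable {R : Type u} {A : Type v} [CommRing R] [CommRing A] [Algebra R A]

theorem IsQuadraticAlgebra.exists_sq_eq (h : IsQuadraticAlgebra R A) (s : A) :
    ∃ a b : R, s ^ 2 = algebraMap R A a + algebraMap R A b * s := by
  obtain ⟨a, b, c, hs⟩ := h s s
  exact ⟨a, b + c, by rw [pow_two, hs, map_add]; ring⟩

theorem finite_of_forall_exists_eq_add_mul (s : A)
    (h : ∀ v : A, ∃ a b : R, v = algebraMap R A a + algebraMap R A b * s) :
    Module.Finite R A := by
  suffices hs : Submodule.span R ({1, s} : Set A) = ⊤ from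
    Module.finite_def.mpr (hs ▸ Submodule.fg_span (by simp))
  rw [eq_top_iff]
  intro v _
  obtain ⟨a, b, hv⟩ := h v
  rw [Submodule.mem_span_pair]
  exact ⟨a, b, by rw [hv]; simp [Algebra.smul_def]⟩

end

variable {R : Type u} {A : Type v} [CommRing R] [IsLocalRing R] [CommRing A] [Algebra R A]
  [Algebra.IsIntegral R A]

theorem algebraMap_mem_iff_of_isMaximal (Q : Ideal A) [hQ : Q.IsMaximal] (r : R) :
    algebraMap R A r ∈ Q ↔ r ∈ maximalIdeal R := by
  have := Ideal.isMaximal_comap_of_isIntegral_of_isMaximal (R := R) Q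
  rw [← eq_maximalIdeal this, Ideal.mem_comap]

/-- An integral quadratic algebra over a local ring has at most three maximal ideals. -/
theorem IsQuadraticAlgebra.finite_maximalSpectrum (h : IsQuadraticAlgebra R A) :
    Finite (MaximalSpectrum A) := by
  by_contra hinf
  rw [not_finite_iff_infinite] at hinf
  let e := Infinite.natEmbedding (MaximalSpectrum A)
  let P : Fin 4 → Ideal A := fun i => (e i).asIdeal
  have hmax : ∀ i, (P i).IsMaximal := fun i => (e i).isMaximal
  have hP : Pairwise (Function.onFun IsCoprime P) := by
    intro i j hij
    rw [Function.onFun, Ideal.isCoprime_iff_sup_eq]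
    refine Ideal.IsMaximal.coprime_of_ne (hmax i) (hmax j) fun hne => hij ?_
    exact Fin.val_injective (e.injective (MaximalSpectrum.ext hne))
  -- At the four ideals (s, t) is (1,0), (1,1), (0,1), (0,0). In st = a + bs + ct the last point
  -- gives a ≡ 0, the first b ≡ 0, the third c ≡ 0, and the second then reads 1 ≡ 0.
  obtain ⟨s, hs⟩ := Ideal.exists_forall_sub_mem_ideal hP ![1, 1, 0, 0]
  obtain ⟨t, ht⟩ := Ideal.exists_forall_sub_mem_ideal hP ![0, 1, 1, 0]
  obtain ⟨a, b, c, hst⟩ := h s t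
  have hs0 := hs 0
  have hs1 := hs 1
  have hs2 := hs 2
  have hs3 := hs 3
  have ht0 := ht 0
  have ht1 := ht 1
  have ht2 := ht 2
  have ht3 := ht 3
  simp only [Matrix.cons_val, sub_zero] at hs0 hs1 hs2 hs3 ht0 ht1 ht2 ht3
  have mem : ∀ (r : R) (i : Fin 4), algebraMap R A r ∈ P i ↔ r ∈ maximalIdeal R := fun r i =>
    have := hmax i
    algebraMap_mem_iff_of_isMaximal (P i) r
  have ha : a ∈ maximalIdeal R := by
    rw [← mem a 3]
    have : algebraMap R A a = s * t - algebraMap R A b * s - algebraMap R A c * t := by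
      rw [hst]; ring
    rw [this]
    exact sub_mem (sub_mem (Ideal.mul_mem_left _ _ ht3) (Ideal.mul_mem_left _ _ hs3))
      (Ideal.mul_mem_left _ _ ht3)
  have hb : b ∈ maximalIdeal R := by
    rw [← mem b 0]
    have : algebraMap R A b = s * t - algebraMap R A b * (s - 1) - algebraMap R A c * t
        - algebraMap R A a := by
      rw [hst]; ring
    rw [this]
    exact sub_mem (sub_mem (sub_mem (Ideal.mul_mem_left _ _ ht0) (Ideal.mul_mem_left _ _ hs0))
      (Ideal.mul_mem_left _ _ ht0)) ((mem a 0).mpr ha)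
  have hc : c ∈ maximalIdeal R := by
    rw [← mem c 2]
    have : algebraMap R A c = s * t - algebraMap R A b * s - algebraMap R A c * (t - 1)
        - algebraMap R A a := by
      rw [hst]; ring
    rw [this]
    exact sub_mem (sub_mem (sub_mem (Ideal.mul_mem_right _ _ hs2) (Ideal.mul_mem_left _ _ hs2))
      (Ideal.mul_mem_left _ _ ht2)) ((mem a 2).mpr ha)
  refine (Ideal.ne_top_iff_one _).mp (hmax 1).ne_top ?_
  have : (1 : A) = algebraMap R A a + algebraMap R A b * s + algebraMap R A c * t
      - (s - 1) * t - (t - 1) := by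
    rw [← hst]; ring
  rw [this]
  exact sub_mem (sub_mem (add_mem (add_mem ((mem a 1).mpr ha)
    (Ideal.mul_mem_right _ _ ((mem b 1).mpr hb))) (Ideal.mul_mem_right _ _ ((mem c 1).mpr hc)))
    (Ideal.mul_mem_right _ _ hs1)) ht1

/-- A residue field extension forces finiteness. -/
theorem IsQuadraticAlgebra.finite_of_forall_sub_notMem (h : IsQuadraticAlgebra R A) {Q : Ideal A}
    [hQ : Q.IsMaximal] {s : A} (hs : ∀ r : R, s - algebraMap R A r ∉ Q) :
    Module.Finite R A := by
  obtain ⟨β, α, hsq⟩ := h.exists_sq_eq s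
  refine finite_of_forall_exists_eq_add_mul s fun v => ?_
  obtain ⟨a, b, c, hsv⟩ := h s v
  -- With s² = β + αs and (s - c)v = a + bs, multiplying by the conjugate α - c - s turns s - c into
  -- an element of R. It is a unit because neither factor lies in Q, so v ∈ R + Rs.
  have hp : algebraMap R A (c ^ 2 - α * c - β) =
      (s - algebraMap R A c) * (algebraMap R A (α - c) - s) := by
    simp only [map_sub, map_mul, map_pow]
    linear_combination hsq
  have hu : IsUnit (c ^ 2 - α * c - β) := by
    rw [← notMem_maximalIdeal, ← algebraMap_mem_iff_of_isMaximal Q, hp]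
    intro hmem
    rcases hQ.isPrime.mem_or_mem hmem with h1 | h1
    · exact hs c h1
    · exact hs (α - c) (by rw [← neg_sub]; exact neg_mem h1)
  obtain ⟨u, hu⟩ := hu.exists_right_inv
  have hu' : algebraMap R A (c ^ 2 - α * c - β) * algebraMap R A u = 1 := by
    rw [← map_mul, hu, map_one]
  have hv : algebraMap R A (c ^ 2 - α * c - β) * v =
      algebraMap R A (a * (α - c) - b * β) + algebraMap R A (-a - b * c) * s := by
    rw [hp]
    simp only [map_sub, map_mul, map_neg]
    linear_combination (algebraMap R A α - algebraMap R A c - s) * hsv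
      - algebraMap R A b * hsq
  refine ⟨u * (a * (α - c) - b * β), u * (-a - b * c), ?_⟩
  rw [map_mul, map_mul, mul_assoc, ← mul_add, ← hv, ← mul_assoc, mul_comm (algebraMap R A u), hu',
    one_mul]

/-- Without finiteness the residue field of Q cannot be larger than that of R, so the quotient is a
simple R-module. -/
theorem IsQuadraticAlgebra.isNoetherian_quotient_of_not_finite (h : IsQuadraticAlgebra R A)
    (hfin : ¬ Module.Finite R A) (Q : Ideal A) [hQ : Q.IsMaximal] : IsNoetherian R (A ⧸ Q) := by
  have hsurj : Function.Surjective (algebraMap R (A ⧸ Q)) := by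
    intro y
    obtain ⟨s, rfl⟩ := Ideal.Quotient.mk_surjective y
    by_contra! hcon
    refine hfin (h.finite_of_forall_sub_notMem (Q := Q) (s := s) fun r hr => hcon r ?_)
    exact ((Ideal.Quotient.eq (I := Q)).mpr hr).symm
  let f : (R ⧸ maximalIdeal R) →ₗ[R] A ⧸ Q :=
    Submodule.liftQ _ (Algebra.linearMap R (A ⧸ Q)) (by
      intro r hr
      rw [LinearMap.mem_ker, Algebra.linearMap_apply, IsScalarTower.algebraMap_apply R A (A ⧸ Q),
        Ideal.Quotient.algebraMap_eq, Ideal.Quotient.eq_zero_iff_mem]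
      exact (algebraMap_mem_iff_of_isMaximal Q r).mpr hr)
  have : IsNoetherian R (R ⧸ maximalIdeal R) := by
    have : IsSimpleModule R (R ⧸ maximalIdeal R) :=
      isSimpleModule_iff_isCoatom.mpr (Ideal.isMaximal_def.mp inferInstance)
    infer_instance
  refine isNoetherian_of_surjective f ?_
  rw [LinearMap.range_eq_top]
  intro y
  obtain ⟨r, rfl⟩ := hsurj y
  exact ⟨Submodule.Quotient.mk r, rfl⟩

/-- If an integral quadratic algebra over a local ring is not local, then it is finite. -/
theorem IsQuadraticAlgebra.finite_of_not_isLocalRing [Nontrivial A] (h : IsQuadraticAlgebra R A)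
    (hloc : ¬ IsLocalRing A) : Module.Finite R A := by
  by_contra hfin
  obtain ⟨Q₁, Q₂, hQ₁, hQ₂, hne⟩ : ∃ Q₁ Q₂ : Ideal A, Q₁.IsMaximal ∧ Q₂.IsMaximal ∧ Q₁ ≠ Q₂ := by
    by_contra! hcon
    obtain ⟨Q, hQ⟩ := Ideal.exists_maximal A
    exact hloc (IsLocalRing.of_unique_max_ideal ⟨Q, hQ, fun Q' hQ' => hcon _ _ hQ' hQ⟩)
  obtain ⟨s, hs₁, t, hs₂, hst⟩ := Submodule.mem_sup.mp
    ((Ideal.eq_top_iff_one _).mp (Ideal.IsMaximal.coprime_of_ne hQ₁ hQ₂ hne))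
  have hs₂ : 1 - s ∈ Q₂ := by rw [← hst]; simpa using hs₂
  have key : ∀ y : A, y ∈ Q₁ → 1 - y ∈ Q₂ → ∃ a b : R, y ^ 2 = algebraMap R A a +
      algebraMap R A b * y ∧ a ∈ maximalIdeal R ∧ 1 - b ∈ maximalIdeal R := by
    intro y hy₁ hy₂
    obtain ⟨a, b, hy⟩ := h.exists_sq_eq y
    have ha : a ∈ maximalIdeal R := by
      rw [← algebraMap_mem_iff_of_isMaximal Q₁]
      have : algebraMap R A a = (y - algebraMap R A b) * y := by
        linear_combination -hy
      rw [this]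
      exact Ideal.mul_mem_left _ _ hy₁
    refine ⟨a, b, hy, ha, ?_⟩
    rw [← algebraMap_mem_iff_of_isMaximal Q₂, map_sub, map_one]
    have : 1 - algebraMap R A b = algebraMap R A a + (1 + y - algebraMap R A b) * (1 - y) := by
      linear_combination hy
    rw [this]
    exact add_mem ((algebraMap_mem_iff_of_isMaximal Q₂ a).mpr ha) (Ideal.mul_mem_left _ _ hy₂)
  have hJ : ∀ w : A, (∀ Q : Ideal A, Q.IsMaximal → w ∈ Q) →
      ∃ a b : R, w = algebraMap R A a + algebraMap R A b * s := by
    intro w hw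
    -- If the linear coefficient f is a unit, so is w - f, because w lies in every maximal ideal.
    -- Then w = eu with e ∈ m, and squaring eu gives a relation whose linear coefficient is a
    -- multiple of e.
    obtain ⟨e, f, hwf, hf⟩ : ∃ e f : R, w ^ 2 = algebraMap R A e + algebraMap R A f * w ∧
        f ∈ maximalIdeal R := by
      obtain ⟨e, f, hwf⟩ := h.exists_sq_eq w
      by_cases hf : f ∈ maximalIdeal R
      · exact ⟨e, f, hwf, hf⟩
      have he : e ∈ maximalIdeal R := by
        rw [← algebraMap_mem_iff_of_isMaximal Q₁]
        have : algebraMap R A e = (w - algebraMap R A f) * w := by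
          linear_combination -hwf
        rw [this]
        exact Ideal.mul_mem_left _ _ (hw Q₁ hQ₁)
      have hu : IsUnit (w - algebraMap R A f) := by
        by_contra hnu
        obtain ⟨Q, hQ, hmem⟩ := exists_max_ideal_of_mem_nonunits hnu
        refine hf ((algebraMap_mem_iff_of_isMaximal Q f).mp ?_)
        have := sub_mem (hw Q hQ) hmem
        simpa using this
      obtain ⟨u, hu⟩ := hu.exists_right_inv
      have hwu : w = algebraMap R A e * u := by
        linear_combination -w * hu + u * hwf
      obtain ⟨e', f', huf⟩ := h.exists_sq_eq u
      refine ⟨e ^ 2 * e', e * f', ?_, Ideal.mul_mem_right _ _ he⟩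
      rw [hwu]
      simp only [map_mul, map_pow]
      linear_combination algebraMap R A e ^ 2 * huf
    obtain ⟨β, α, hsq, hβ, hα⟩ := key s hs₁ hs₂
    obtain ⟨a, c, hsw, ha, hc⟩ := key (s + w) (add_mem hs₁ (hw Q₁ hQ₁)) (by
      rw [← sub_sub]; exact sub_mem hs₂ (hw Q₂ hQ₂))
    -- Subtracting the quadratic relations of s and w from that of s + w leaves w(2s - g) ∈ R + Rs,
    -- with g = c - f. The product of 2s - g and its conjugate 2α - g - 2s is g² - 2gα - 4β, which
    -- is ≡ -1 since g ≡ α ≡ 1 and β ≡ 0; residue characteristic 2 is no exception.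
    have hu : IsUnit ((c - f) ^ 2 - 2 * (c - f) * α - 4 * β) := by
      rw [← notMem_maximalIdeal]
      intro hmem
      rw [← residue_eq_zero_iff] at hmem hf hβ hα hc
      simp only [map_sub, map_mul, map_pow, map_ofNat, map_one] at hmem hα hc
      refine one_ne_zero (α := ResidueField R) ?_
      rw [← sub_eq_zero.mp hα, ← sub_eq_zero.mp hc, hf, hβ] at hmem
      linear_combination -hmem
    obtain ⟨u, hu⟩ := hu.exists_right_inv
    have hu' := congrArg (algebraMap R A) hu
    simp only [map_sub, map_mul, map_pow, map_ofNat, map_one] at hu'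
    have hlin : w * (2 * s - algebraMap R A (c - f)) =
        algebraMap R A (a - β - e) + algebraMap R A (c - α) * s := by
      simp only [map_sub]
      linear_combination hsw - hsq - hwf
    refine ⟨u * ((a - β - e) * (2 * α - (c - f)) - 2 * (c - α) * β),
      u * (-2 * (a - β - e) - (c - α) * (c - f)), ?_⟩
    simp only [map_sub, map_mul, map_ofNat, map_neg] at hlin ⊢
    generalize algebraMap R A u = u at *
    generalize algebraMap R A a = a at *
    generalize algebraMap R A β = β at *
    generalize algebraMap R A e = e at *
    generalize algebraMap R A c = c at *
    generalize algebraMap R A α = α at *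
    generalize algebraMap R A f = f at *
    linear_combination (-w) * hu' + u * (2 * α - 2 * s - (c - f)) * hlin
      + u * (4 * w - 2 * (c - α)) * hsq
  -- The Jacobson radical lies in R + Rs, and modulo it A embeds in a finite product of residue
  -- fields, each Noetherian over R. So A is finite after all.
  let π : A →ₗ[R] (Q : MaximalSpectrum A) → A ⧸ Q.asIdeal :=
    LinearMap.pi fun Q => (Ideal.Quotient.mkₐ R Q.asIdeal).toLinearMap
  have hker : ∀ w : A, w ∈ LinearMap.ker π ↔ ∀ Q : Ideal A, Q.IsMaximal → w ∈ Q := by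
    intro w
    rw [LinearMap.mem_ker, funext_iff]
    refine ⟨fun hw Q hQ => Ideal.Quotient.eq_zero_iff_mem.mp (hw ⟨Q, hQ⟩), fun hw Q =>
      Ideal.Quotient.eq_zero_iff_mem.mpr (hw Q.asIdeal Q.isMaximal)⟩
  have := h.finite_maximalSpectrum
  have : ∀ Q : MaximalSpectrum A, IsNoetherian R (A ⧸ Q.asIdeal) := fun Q =>
    have := Q.isMaximal
    h.isNoetherian_quotient_of_not_finite hfin Q.asIdeal
  have hfin1 : Module.Finite R (A ⧸ LinearMap.ker π) :=
    Module.Finite.equiv π.quotKerEquivRange.symm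
  have hle : LinearMap.ker π ≤ Submodule.span R {1, s} := by
    intro w hw
    obtain ⟨a, b, hab⟩ := hJ w ((hker w).mp hw)
    rw [Submodule.mem_span_pair]
    exact ⟨a, b, by rw [hab]; simp [Algebra.smul_def]⟩
  have hfin2 : Module.Finite R (A ⧸ Submodule.span R ({1, s} : Set A)) :=
    Module.Finite.of_surjective (Submodule.factor hle) (Submodule.factor_surjective hle)
  have hfin3 : Module.Finite R (Submodule.span R ({1, s} : Set A)) :=
    Module.Finite.iff_fg.mpr (Submodule.fg_span (by simp))
  exact hfin (Module.Finite.of_submodule_quotient (Submodule.span R ({1, s} : Set A)))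

end Quadratic

/-! ### Quadratic valuation rings: V = R + xV -/

section QuadraticValuation

open IsLocalRing

variable {R : Type u} {A : Type v} [CommRing R] [IsLocalRing R] [CommRing A] [Algebra R A]
  [Algebra.IsIntegral R A] [IsLocalRing A]

/-- The square of a nonunit of a quadratic local extension lies in the ideal generated by the
maximal ideal of the base. -/
theorem IsQuadraticAlgebra.sq_mem (h : IsQuadraticAlgebra R A) {I : Ideal A}
    (hI : ∀ r ∈ maximalIdeal R, algebraMap R A r ∈ I) {y : A} (hy : y ∈ maximalIdeal A) :
    y ^ 2 ∈ I := by
  obtain ⟨a, b, hsq⟩ := h.exists_sq_eq y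
  have ha : a ∈ maximalIdeal R := by
    rw [← algebraMap_mem_iff_of_isMaximal (maximalIdeal A)]
    have : algebraMap R A a = (y - algebraMap R A b) * y := by linear_combination -hsq
    rw [this]
    exact Ideal.mul_mem_left _ _ hy
  by_cases hb : b ∈ maximalIdeal R
  · rw [hsq]
    exact add_mem (hI a ha) (Ideal.mul_mem_right _ _ (hI b hb))
  · have hu : IsUnit (y - algebraMap R A b) := by
      rw [← notMem_maximalIdeal]
      intro hmem
      refine hb ((algebraMap_mem_iff_of_isMaximal (maximalIdeal A) b).mp ?_)
      simpa using sub_mem hy hmem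
    have h1 : (y - algebraMap R A b) * y ∈ I := by
      have : (y - algebraMap R A b) * y = algebraMap R A a := by linear_combination hsq
      rw [this]
      exact hI a ha
    rw [pow_two]
    exact Ideal.mul_mem_left _ _ ((Ideal.unit_mul_mem_iff_mem _ hu).mp h1)

theorem IsQuadraticAlgebra.dvd_sq (h : IsQuadraticAlgebra R A) {x : A}
    (hdvd : ∀ r ∈ maximalIdeal R, x ∣ algebraMap R A r) {y : A} (hy : y ∈ maximalIdeal A) :
    x ∣ y ^ 2 :=
  Ideal.mem_span_singleton.mp
    (h.sq_mem (fun r hr => Ideal.mem_span_singleton.mpr (hdvd r hr)) hy)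

/-- An integral quadratic valuation ring over a local ring `R` that is not finite over `R` is
spanned by `R` modulo the extension of the maximal ideal of `R`, provided that this extension is
principal. -/
theorem IsQuadraticAlgebra.exists_eq_add_mul [IsDomain A] (h : IsQuadraticAlgebra R A)
    (hval : ∀ a b : A, a ∣ b ∨ b ∣ a) (hfin : ¬ Module.Finite R A) {x : A} (hx0 : x ≠ 0)
    (hdvd : ∀ r ∈ maximalIdeal R, x ∣ algebraMap R A r) (v : A) :
    ∃ (r : R) (w : A), v = algebraMap R A r + x * w := by
  by_contra! hcon
  have mem : ∀ r : R, algebraMap R A r ∈ maximalIdeal A ↔ r ∈ maximalIdeal R :=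
    algebraMap_mem_iff_of_isMaximal (maximalIdeal A)
  have hres : ∀ y : A, ∃ r : R, y - algebraMap R A r ∈ maximalIdeal A := by
    intro y
    by_contra! hy
    exact hfin (h.finite_of_forall_sub_notMem hy)
  obtain ⟨r₀, hr₀⟩ := hres v
  set s := v - algebraMap R A r₀ with hs
  have hxs : ¬ x ∣ s := by
    rintro ⟨w, hw⟩
    exact hcon r₀ w (by rw [← hw, hs]; ring)
  have hs0 : s ≠ 0 := fun h0 => hxs (h0 ▸ dvd_zero x)
  obtain ⟨y, hy⟩ := (hval x s).resolve_left hxs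
  have hyJ : y ∈ maximalIdeal A := by
    by_contra hyu
    rw [notMem_maximalIdeal] at hyu
    exact hxs (hy ▸ (hyu.mul_right_dvd.mpr dvd_rfl))
  obtain ⟨z, hz⟩ := h.dvd_sq hdvd hr₀
  have hsyz : s = y * z := by
    refine mul_left_cancel₀ hs0 ?_
    rw [← mul_assoc, ← hy, ← hz, pow_two]
  -- From x = sy and s = yz follows x = y²z, and x divides y²; so z is a unit, and x and s² are
  -- associates.
  have hzu : IsUnit z := by
    rw [← notMem_maximalIdeal]
    intro hzJ
    obtain ⟨z', hz'⟩ := h.dvd_sq hdvd hyJ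
    have h1 : x * (z' * z) = x * 1 := by
      rw [mul_one]
      conv_rhs => rw [hy, hsyz]
      linear_combination -z * hz'
    have h2 := mul_left_cancel₀ hx0 h1
    exact (maximalIdeal.isMaximal A).ne_top
      ((Ideal.eq_top_iff_one _).mpr (h2 ▸ Ideal.mul_mem_left _ _ hzJ))
  have hsqdvd : s ^ 2 ∣ x := hz ▸ hzu.mul_right_dvd.mpr dvd_rfl
  obtain ⟨β, α, hsq⟩ := h.exists_sq_eq s
  have hβ : β ∈ maximalIdeal R := by
    rw [← mem]
    have : algebraMap R A β = (s - algebraMap R A α) * s := by linear_combination -hsq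
    rw [this]
    exact Ideal.mul_mem_left _ _ hr₀
  have hα : α ∈ maximalIdeal R := by
    by_contra hα
    have hu : IsUnit (s - algebraMap R A α) := by
      rw [← notMem_maximalIdeal]
      intro hmem
      exact hα ((mem α).mp (by simpa using sub_mem hr₀ hmem))
    refine hxs (hu.dvd_mul_left.mp ?_)
    have : (s - algebraMap R A α) * s = algebraMap R A β := by linear_combination hsq
    rw [this]
    exact hdvd β hβ
  -- β = s² - αs, where αs is a multiple of xs, so β is x times a unit and may replace x as
  -- generator of the extension of m.
  have hβx : algebraMap R A β ∣ x := by
    obtain ⟨α', hα'⟩ := hdvd α hα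
    have hu : IsUnit (z - α' * s) := by
      rw [← notMem_maximalIdeal] at hzu ⊢
      intro hmem
      exact hzu (by simpa using add_mem hmem (Ideal.mul_mem_left _ α' hr₀))
    have : algebraMap R A β = x * (z - α' * s) := by
      linear_combination -hsq + hz - s * hα'
    rw [this]
    exact hu.mul_right_dvd.mpr dvd_rfl
  have hβ0 : algebraMap R A β ≠ 0 := fun h0 => hx0 (zero_dvd_iff.mp (h0 ▸ hβx))
  have hβdvd : ∀ r ∈ maximalIdeal R, ∃ w, algebraMap R A r = algebraMap R A β * w := fun r hr =>
    hβx.trans (hdvd r hr)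
  -- products of two elements of the maximal ideal are multiples of `β` by nonunits
  have hmm : ∀ c ∈ maximalIdeal R, ∃ ρ ∈ maximalIdeal R,
      algebraMap R A (c ^ 2 - α * c) = algebraMap R A (β * ρ) := by
    intro c hc
    obtain ⟨c', hc'⟩ := hβdvd c hc
    obtain ⟨α', hα'⟩ := hβdvd α hα
    obtain ⟨p, q, r, hpqr⟩ := h c' (c' - α')
    refine ⟨β * p + q * c + r * (c - α), ?_, ?_⟩
    · exact add_mem (add_mem (Ideal.mul_mem_right _ _ hβ) (Ideal.mul_mem_left _ _ hc))
        (Ideal.mul_mem_left _ _ (sub_mem hc hα))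
    · simp only [map_sub, map_mul, map_pow, map_add]
      rw [hc', hα']
      linear_combination (algebraMap R A β) ^ 2 * hpqr
  -- As in the residue field argument, p(c)y ∈ R + Rs for p(T) = T² - αT - β. It remains to see that
  -- p(c) divides β in R: it is a unit if c ∉ m, and β times a unit if c ∈ m.
  have hxR : ∀ y : A, ∃ a b : R, algebraMap R A β * y = algebraMap R A a + algebraMap R A b * s := by
    intro y
    obtain ⟨a, b, c, hsy⟩ := h s y
    have hp : algebraMap R A (c ^ 2 - α * c - β) * y =
        algebraMap R A (a * (α - c) - b * β) + algebraMap R A (-a - b * c) * s := by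
      simp only [map_sub, map_mul, map_neg, map_pow]
      linear_combination (algebraMap R A α - algebraMap R A c - s) * hsy
        + (y - algebraMap R A b) * hsq
    obtain ⟨ε, hε⟩ : ∃ ε : R,
        algebraMap R A (ε * (c ^ 2 - α * c - β)) = algebraMap R A β := by
      by_cases hc : c ∈ maximalIdeal R
      · obtain ⟨ρ, hρ, hcρ⟩ := hmm c hc
        have hu : IsUnit (ρ - 1) := by
          rw [← notMem_maximalIdeal]
          intro hmem
          exact (Ideal.ne_top_iff_one _).mp (maximalIdeal.isMaximal R).ne_top
            (by simpa using sub_mem hρ hmem)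
        obtain ⟨ε, hε⟩ := hu.exists_right_inv
        refine ⟨ε, ?_⟩
        have hε' := congrArg (algebraMap R A) hε
        simp only [map_sub, map_mul, map_pow, map_one] at hε' hcρ ⊢
        linear_combination algebraMap R A ε * hcρ + algebraMap R A β * hε'
      · have hu : IsUnit (c ^ 2 - α * c - β) := by
          rw [← notMem_maximalIdeal]
          intro hmem
          refine hc ((maximalIdeal.isMaximal R).isPrime.mem_of_pow_mem 2 ?_)
          have : c ^ 2 = (c ^ 2 - α * c - β) + c * α + β := by ring
          rw [this]
          exact add_mem (add_mem hmem (Ideal.mul_mem_left _ _ hα)) hβ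
        obtain ⟨ε, hε⟩ := hu.exists_right_inv
        exact ⟨β * ε, by rw [mul_assoc, mul_comm ε, hε, mul_one]⟩
    refine ⟨ε * (a * (α - c) - b * β), ε * (-a - b * c), ?_⟩
    rw [← hε, map_mul, mul_assoc, hp]
    simp only [map_mul]
    ring
  -- Once s generates the maximal ideal of A, expanding y to second order gives A = R + Rs + s²A;
  -- since s²A = βA ⊆ R + Rs, A would be finite.
  refine hfin (finite_of_forall_exists_eq_add_mul s ?_)
  have hsJ : ∀ j ∈ maximalIdeal A, s ∣ j := by
    intro j hj
    rcases hval s j with h1 | ⟨j', hj'⟩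
    · exact h1
    have h1 : s ^ 2 ∣ j ^ 2 := hsqdvd.trans (h.dvd_sq hdvd hj)
    by_cases hj0 : j = 0
    · rw [hj0]; exact dvd_zero _
    obtain ⟨w, hw⟩ := h1
    have h2 : j ^ 2 * (j' * (j' * w)) = j ^ 2 * 1 := by
      rw [mul_one]
      conv_rhs => rw [hw, hj']
      ring
    have h3 : IsUnit j' := IsUnit.of_mul_eq_one _ (mul_left_cancel₀ (pow_ne_zero 2 hj0) h2)
    rw [hj']
    exact h3.mul_right_dvd.mpr dvd_rfl
  intro y
  obtain ⟨r, hr⟩ := hres y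
  obtain ⟨j, hj⟩ := hsJ _ hr
  obtain ⟨r', hr'⟩ := hres j
  obtain ⟨j', hj'⟩ := hsJ _ hr'
  have h1 : algebraMap R A β ∣ s ^ 2 * j' :=
    Dvd.dvd.mul_right (hβx.trans ⟨z, hz⟩) _
  obtain ⟨w, hw⟩ := h1
  obtain ⟨a, b, hab⟩ := hxR w
  refine ⟨r + a, r' + b, ?_⟩
  simp only [map_add]
  linear_combination hj + s * hj' + hw + hab

end QuadraticValuation

/-- The structure of a bad stable domain `R` with quotient field `F`: its integral closure is a
discrete valuation ring, quadratic over `R`, whose uniformizer `x` can be chosen in `R`, and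
multiplication by `x` is onto on the integral closure modulo `R`. -/
structure IsTwistedDomain (R : Type u) (F : Type v) [CommRing R] [Field F] [Algebra R F]
    (x : R) : Prop where
  ne_zero : x ≠ 0
  not_isUnit : ¬ IsUnit x
  mul_eq : ∀ s t : F, IsIntegral R s → IsIntegral R t →
    ∃ a b c : R, s * t = algebraMap R F a + algebraMap R F b * s + algebraMap R F c * t
  eq_add_mul : ∀ s : F, IsIntegral R s →
    ∃ (r : R) (w : F), IsIntegral R w ∧ s = algebraMap R F r + algebraMap R F x * w
  pow_mul_mem : ∀ y : F, ∃ (n : ℕ) (r : R), algebraMap R F x ^ n * y = algebraMap R F r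
  inv_or_div : ∀ s : F, IsIntegral R s → IsIntegral R s⁻¹ ∨ IsIntegral R (s / algebraMap R F x)
  exists_notMem : ∃ s : F, IsIntegral R s ∧ ∀ r, s ≠ algebraMap R F r

/-! ### Structure of bad stable domains -/

section Structure

open IsLocalRing

variable (R : Type u) (F : Type v) [CommRing R] [Field F] [Algebra R F] [IsFractionRing R F]

theorem hasFiniteNormalization_iff [IsDomain R] :
    HasFiniteNormalization R ↔ Module.Finite R (integralClosure R F) :=
  Module.Finite.equiv_iff (FractionRing.algEquiv R F).mapIntegralClosure.toLinearEquiv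

variable [IsBadStableDomain R]

theorem isQuadraticAlgebra_integralClosure : IsQuadraticAlgebra R (integralClosure R F) := by
  intro s t
  obtain ⟨a, b, c, h⟩ := IsStableDomain.exists_mul_eq s.2 t.2
  exact ⟨a, b, c, Subtype.val_injective h⟩

theorem not_finite_integralClosure : ¬ Module.Finite R (integralClosure R F) := fun h =>
  IsBadStableDomain.not_finite (R := R) ((hasFiniteNormalization_iff R F).mpr h)

theorem isLocalRing_integralClosure : IsLocalRing (integralClosure R F) := by
  by_contra h
  exact not_finite_integralClosure R F
    ((isQuadraticAlgebra_integralClosure R F).finite_of_not_isLocalRing h)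

theorem dvd_total_integralClosure (a b : integralClosure R F) : a ∣ b ∨ b ∣ a := by
  have := isLocalRing_integralClosure R F
  by_cases hb : b = 0
  · left; rw [hb]; exact dvd_zero a
  by_cases ha : a = 0
  · right; rw [ha]; exact dvd_zero b
  have ha' : (a : F) ≠ 0 := fun h => ha (Subtype.val_injective h)
  have hb' : (b : F) ≠ 0 := fun h => hb (Subtype.val_injective h)
  rcases IsStableDomain.isIntegral_or_isIntegral_inv (R := R) ((b : F) / a) with h | h
  · left
    exact ⟨⟨_, h⟩, Subtype.val_injective (mul_div_cancel₀ _ ha').symm⟩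
  · right
    rw [inv_div] at h
    exact ⟨⟨_, h⟩, Subtype.val_injective (mul_div_cancel₀ _ hb').symm⟩

variable {R} in
theorem exists_dvd_pow {a : R} (ha : a ≠ 0) {r : R} (hr : r ∈ maximalIdeal R) :
    ∃ n : ℕ, a ∣ r ^ n := by
  have := (ringKrullDim_eq_one_iff_of_isLocalRing_isDomain.mp
    (IsBadStableDomain.krullDim_eq_one (R := R))).2 a ha hr
  obtain ⟨n, hn⟩ := this
  exact ⟨n, Ideal.mem_span_singleton.mp hn⟩

theorem exists_mem_maximalIdeal_ne_zero : ∃ a ∈ maximalIdeal R, a ≠ 0 := by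
  have h := (ringKrullDim_eq_one_iff_of_isLocalRing_isDomain.mp
    (IsBadStableDomain.krullDim_eq_one (R := R))).1
  rw [isField_iff_maximalIdeal_eq] at h
  exact Submodule.exists_mem_ne_zero_of_ne_bot h

variable {R F} in
/-- Endomorphisms of the maximal ideal are integral. -/
theorem isIntegral_of_mul_mem_maximalIdeal {y : F}
    (hy : ∀ b ∈ maximalIdeal R, ∃ b' ∈ maximalIdeal R,
      y * algebraMap R F b = algebraMap R F b') : IsIntegral R y := by
  have := isLocalRing_integralClosure R F
  by_contra hcon
  have hz := (IsStableDomain.isIntegral_or_isIntegral_inv (R := R) y).resolve_left hcon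
  have hy0 : y ≠ 0 := by rintro rfl; exact hcon isIntegral_zero
  set z : integralClosure R F := ⟨y⁻¹, hz⟩ with hzdef
  have hzJ : z ∈ maximalIdeal (integralClosure R F) := by
    rw [mem_maximalIdeal, mem_nonunits_iff]
    intro hu
    obtain ⟨w, hw⟩ := hu.exists_right_inv
    have h1 : y⁻¹ * (w : F) = 1 := congrArg Subtype.val hw
    have h2 : (w : F) = y := by
      rw [inv_mul_eq_div, div_eq_one_iff_eq hy0] at h1; exact h1
    exact hcon (h2 ▸ w.2)
  obtain ⟨a, ham, ha⟩ := exists_mem_maximalIdeal_ne_zero R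
  -- If y is not integral, z = y⁻¹ is a nonunit of V, and some zⁿ is a multiple of a because m lies
  -- in the radical of aV. But a = zⁿ⁺¹(yⁿ⁺¹a) with yⁿ⁺¹a ∈ R, so zⁿ would be a multiple of zⁿ⁺¹.
  have hpow : ∀ n : ℕ, ∃ b ∈ maximalIdeal R, y ^ n * algebraMap R F a = algebraMap R F b := by
    intro n
    induction n with
    | zero => exact ⟨a, ham, by simp⟩
    | succ n ih =>
      obtain ⟨b, hb, h1⟩ := ih
      obtain ⟨b', hb', h2⟩ := hy b hb
      exact ⟨b', hb', by rw [pow_succ', mul_assoc, h1, h2]⟩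
  have hrad : z ∈ (Ideal.span {algebraMap R (integralClosure R F) a}).radical := by
    have h1 := (isQuadraticAlgebra_integralClosure R F).sq_mem
      (I := (Ideal.span {algebraMap R (integralClosure R F) a}).radical) (fun r hr => by
        obtain ⟨n, hn⟩ := exists_dvd_pow ha hr
        exact ⟨n, Ideal.mem_span_singleton.mpr (by rw [← map_pow]; exact map_dvd _ hn)⟩) hzJ
    exact (Ideal.radical_isRadical _) ⟨2, h1⟩
  obtain ⟨n, hn⟩ := hrad
  obtain ⟨w, hw⟩ := Ideal.mem_span_singleton.mp hn
  obtain ⟨b, -, hb⟩ := hpow (n + 1)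
  have h1 : algebraMap R (integralClosure R F) a =
      z ^ (n + 1) * algebraMap R (integralClosure R F) b := by
    refine Subtype.val_injective ?_
    change algebraMap R F a = y⁻¹ ^ (n + 1) * algebraMap R F b
    rw [← hb, ← mul_assoc, ← mul_pow, inv_mul_cancel₀ hy0, one_pow, one_mul]
  have hz0 : z ≠ 0 := fun h0 => inv_ne_zero hy0 (congrArg Subtype.val h0)
  have h2 : z ^ n * (z * (algebraMap R (integralClosure R F) b * w)) = z ^ n * 1 := by
    rw [mul_one]
    conv_rhs => rw [hw, h1]
    ring
  have h3 := mul_left_cancel₀ (pow_ne_zero n hz0) h2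
  exact (Ideal.ne_top_iff_one _).mp (maximalIdeal.isMaximal (integralClosure R F)).ne_top
    (h3 ▸ Ideal.mul_mem_right _ _ hzJ)

/-- The extension of the maximal ideal of a bad stable domain to its integral closure is generated
by an element of the maximal ideal. -/
theorem exists_forall_dvd_algebraMap : ∃ x ∈ maximalIdeal R, x ≠ 0 ∧
    ∀ r ∈ maximalIdeal R, algebraMap R (integralClosure R F) x ∣ algebraMap R _ r := by
  have := isLocalRing_integralClosure R F
  have hne : maximalIdeal R ≠ ⊥ := by
    obtain ⟨a, ha, ha0⟩ := exists_mem_maximalIdeal_ne_zero R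
    exact (Submodule.ne_bot_iff _).mpr ⟨a, ha, ha0⟩
  have h1 := (IsStableDomain.stable _ hne).one_mem_mul_div (F := F) hne
  set M := Submodule.map (Algebra.linearMap R F) (maximalIdeal R) with hM
  have hint : ∀ p ∈ M, ∀ n ∈ M / (M * M), IsIntegral R (p * n) := by
    intro p hp n hn
    refine isIntegral_of_mul_mem_maximalIdeal fun b hb => ?_
    obtain ⟨b', hb', h⟩ := Submodule.mem_div_iff_forall_mul_mem.mp hn _
      (Submodule.mul_mem_mul hp (Submodule.mem_map_of_mem hb))
    refine ⟨b', hb', ?_⟩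
    rw [Algebra.linearMap_apply] at h
    rw [h, Algebra.linearMap_apply]
    ring
  -- The products pn sum to 1 in the local ring V, so one of them is a unit. That p is the required
  -- x, since r = p · (rn)(pn)⁻¹ for r ∈ m.
  obtain ⟨p, hp, n, hn, hu⟩ : ∃ p, ∃ hp : p ∈ M, ∃ n, ∃ hn : n ∈ M / (M * M),
      IsUnit (⟨p * n, hint p hp n hn⟩ : integralClosure R F) := by
    by_contra! hcon
    have key : ∀ z ∈ M * (M / (M * M)), ∃ w ∈ maximalIdeal (integralClosure R F),
        (w : F) = z := by
      intro z hz
      induction hz using Submodule.mul_induction_on' with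
      | mem_mul_mem p hp n hn => exact ⟨_, hcon p hp n hn, rfl⟩
      | add b _ c _ hb hc =>
        obtain ⟨w, hw, rfl⟩ := hb
        obtain ⟨w', hw', rfl⟩ := hc
        exact ⟨w + w', add_mem hw hw', rfl⟩
    obtain ⟨w, hw, hw1⟩ := key 1 h1
    have : w = 1 := Subtype.val_injective hw1
    rw [this] at hw
    exact (Ideal.ne_top_iff_one _).mp (maximalIdeal.isMaximal _).ne_top hw
  obtain ⟨w, hw⟩ := hu.exists_right_inv
  have hw' : p * n * (w : F) = 1 := congrArg Subtype.val hw
  obtain ⟨x, hx, rfl⟩ := hp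
  refine ⟨x, hx, ?_, fun r hr => ?_⟩
  · rintro rfl
    simp at hw'
  · refine ⟨⟨algebraMap R F r * n, hint _ (Submodule.mem_map_of_mem hr) n hn⟩ * w,
      Subtype.val_injective ?_⟩
    rw [Algebra.linearMap_apply] at hw'
    change algebraMap R F r = algebraMap R F x * (algebraMap R F r * n * (w : F))
    linear_combination -(algebraMap R F r) * hw'

/-- The structure theorem for bad stable domains. -/
theorem IsBadStableDomain.exists_isTwistedDomain :
    ∃ x : R, IsTwistedDomain R F x := by
  have := isLocalRing_integralClosure R F
  obtain ⟨x, hxm, hx0, hdvd⟩ := exists_forall_dvd_algebraMap R F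
  have hinj : Function.Injective (algebraMap R F) := IsFractionRing.injective R F
  have hxF : algebraMap R F x ≠ 0 := fun h => hx0 (hinj (by rw [h, map_zero]))
  have hxV : algebraMap R (integralClosure R F) x ≠ 0 := fun h =>
    hxF (congrArg Subtype.val h)
  have hadd : ∀ s : F, IsIntegral R s →
      ∃ (r : R) (w : F), IsIntegral R w ∧ s = algebraMap R F r + algebraMap R F x * w := by
    intro s hs
    obtain ⟨r, w, h⟩ := (isQuadraticAlgebra_integralClosure R F).exists_eq_add_mul
      (dvd_total_integralClosure R F) (not_finite_integralClosure R F) hxV hdvd ⟨s, hs⟩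
    exact ⟨r, w, w.2, congrArg Subtype.val h⟩
  have hdiv : ∀ r ∈ maximalIdeal R, IsIntegral R (algebraMap R F r / algebraMap R F x) := by
    intro r hr
    obtain ⟨w, hw⟩ := hdvd r hr
    have : algebraMap R F r = algebraMap R F x * w := congrArg Subtype.val hw
    rw [this, mul_div_cancel_left₀ _ hxF]
    exact w.2
  have hunit : ∀ r : R, r ∉ maximalIdeal R → ∃ r', algebraMap R F r * algebraMap R F r' = 1 := by
    intro r hr
    rw [notMem_maximalIdeal] at hr
    obtain ⟨r', hr'⟩ := hr.exists_right_inv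
    exact ⟨r', by rw [← map_mul, hr', map_one]⟩
  refine ⟨x, hx0, hxm, fun s t hs ht => IsStableDomain.exists_mul_eq hs ht, hadd, fun y => ?_,
    fun s hs => ?_, ?_⟩
  · obtain ⟨p, q, hq, rfl⟩ := IsFractionRing.div_surjective (A := R) y
    have hq0 := nonZeroDivisors.ne_zero hq
    obtain ⟨n, c, hc⟩ := exists_dvd_pow hq0 hxm
    have hqF : algebraMap R F q ≠ 0 := fun h => hq0 (hinj (by rw [h, map_zero]))
    refine ⟨n, c * p, ?_⟩
    rw [← map_pow, hc, map_mul, map_mul]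
    field_simp
  · obtain ⟨r, w, hw, rfl⟩ := hadd s hs
    by_cases hr : r ∈ maximalIdeal R
    · right
      rw [add_div, mul_div_cancel_left₀ _ hxF]
      exact (hdiv r hr).add hw
    · left
      have hu : IsUnit (⟨_, hs⟩ : integralClosure R F) := by
        rw [← notMem_maximalIdeal]
        intro hmem
        refine hr ((algebraMap_mem_iff_of_isMaximal (maximalIdeal (integralClosure R F)) r).mp ?_)
        have h1 : algebraMap R (integralClosure R F) r =
            ⟨_, hs⟩ - algebraMap R (integralClosure R F) x * ⟨w, hw⟩ :=
          Subtype.val_injective (by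
            change algebraMap R F r = algebraMap R F r + algebraMap R F x * w - algebraMap R F x * w
            ring)
        rw [h1]
        exact sub_mem hmem (Ideal.mul_mem_right _ _
          ((algebraMap_mem_iff_of_isMaximal (maximalIdeal (integralClosure R F)) x).mpr hxm))
      obtain ⟨w', hw'⟩ := hu.exists_right_inv
      rw [inv_eq_of_mul_eq_one_right (show _ * (w' : F) = 1 from congrArg Subtype.val hw')]
      exact w'.2
  -- If V were R, it would be finite over R.
  · by_contra! hcon
    refine not_finite_integralClosure R F (Module.Finite.of_surjective
      (Algebra.linearMap R (integralClosure R F)) fun s => ?_)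
    obtain ⟨r, hr⟩ := hcon s s.2
    exact ⟨r, Subtype.val_injective hr.symm⟩

end Structure

/-! ### Twisted domains are bad stable domains -/

namespace IsTwistedDomain

open IsLocalRing

variable {R : Type u} {F : Type v} [CommRing R] [Field F] [Algebra R F] [IsFractionRing R F]
  {x : R}

theorem algebraMap_ne_zero (h : IsTwistedDomain R F x) : algebraMap R F x ≠ 0 := fun h0 =>
  h.ne_zero (IsFractionRing.injective R F (by rw [h0, map_zero]))

theorem isUnit_of_isIntegral_inv {r : R} (hr : r ≠ 0) (hi : IsIntegral R (algebraMap R F r)⁻¹) :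
    IsUnit r := by
  have hinj := IsFractionRing.injective R F
  have : FaithfulSMul R (integralClosure R F) :=
    (faithfulSMul_iff_algebraMap_injective R _).mpr fun a b hab =>
      hinj (congrArg Subtype.val hab)
  refine isUnit_of_map_unit (algebraMap R (integralClosure R F)) r
    (IsUnit.of_mul_eq_one ⟨_, hi⟩ (Subtype.val_injective ?_))
  have h0 : algebraMap R F r ≠ 0 := fun h0 => hr (hinj (by rw [h0, map_zero]))
  exact mul_inv_cancel₀ h0

theorem not_isIntegral_inv (h : IsTwistedDomain R F x) : ¬ IsIntegral R (algebraMap R F x)⁻¹ :=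
  fun hi => h.not_isUnit (isUnit_of_isIntegral_inv h.ne_zero hi)

/-- The maximal ideal is R ∩ xV: integrality reflects units, and an element of R without integral
inverse is divisible by x in V. -/
theorem not_isUnit_iff (h : IsTwistedDomain R F x) (r : R) :
    ¬ IsUnit r ↔ IsIntegral R (algebraMap R F r / algebraMap R F x) := by
  constructor
  · intro hr
    by_cases hr0 : r = 0
    · rw [hr0, map_zero, zero_div]; exact isIntegral_zero
    exact (h.inv_or_div _ isIntegral_algebraMap).resolve_left fun hi =>
      hr (isUnit_of_isIntegral_inv hr0 hi)
  · intro hi hu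
    obtain ⟨r', hr'⟩ := hu.exists_right_inv
    refine h.not_isIntegral_inv ?_
    have h1 : (algebraMap R F x)⁻¹ =
        algebraMap R F r / algebraMap R F x * algebraMap R F r' := by
      rw [div_mul_eq_mul_div, ← map_mul, hr', map_one, one_div]
    rw [h1]
    exact hi.mul isIntegral_algebraMap

theorem isLocalRing (h : IsTwistedDomain R F x) : IsLocalRing R := by
  have : Nontrivial R := ⟨x, 0, h.ne_zero⟩
  refine IsLocalRing.of_nonunits_add fun a b ha hb => ?_
  rw [mem_nonunits_iff, h.not_isUnit_iff] at *
  rw [map_add, add_div]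
  exact ha.add hb

theorem mem_maximalIdeal_iff [IsLocalRing R] (h : IsTwistedDomain R F x) (r : R) :
    r ∈ maximalIdeal R ↔ IsIntegral R (algebraMap R F r / algebraMap R F x) :=
  h.not_isUnit_iff r

/-- The quadratic relation for a/x and b/x, multiplied by x². It shows m² = xm. -/
theorem exists_mul_eq_mul [IsLocalRing R] (h : IsTwistedDomain R F x) {a b : R}
    (ha : a ∈ maximalIdeal R) (hb : b ∈ maximalIdeal R) :
    ∃ c ∈ maximalIdeal R, a * b = x * c := by
  have hx := h.algebraMap_ne_zero
  obtain ⟨p, q, r, hpqr⟩ := h.mul_eq _ _ ((h.mem_maximalIdeal_iff a).mp ha)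
    ((h.mem_maximalIdeal_iff b).mp hb)
  refine ⟨x * p + q * a + r * b, add_mem (add_mem (Ideal.mul_mem_right _ _ h.not_isUnit)
    (Ideal.mul_mem_left _ _ ha)) (Ideal.mul_mem_left _ _ hb), IsFractionRing.injective R F ?_⟩
  simp only [map_mul, map_add]
  field_simp at hpqr
  linear_combination hpqr

/-- x is a uniformizer of V. Division of s by x must stop, since xᴺs⁻¹ ∈ R for some N and x⁻¹ is not
integral; the last quotient is a unit. -/
theorem exists_eq_pow_mul (h : IsTwistedDomain R F x) {s : F} (hs : IsIntegral R s) (hs0 : s ≠ 0) :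
    ∃ (n : ℕ) (w : F), IsIntegral R w ∧ IsIntegral R w⁻¹ ∧ s = algebraMap R F x ^ n * w := by
  have hx := h.algebraMap_ne_zero
  obtain ⟨N, r, hN⟩ := h.pow_mul_mem s⁻¹
  have hbound : ¬ IsIntegral R (s / algebraMap R F x ^ (N + 1)) := by
    intro hi
    refine h.not_isIntegral_inv ?_
    have h1 : (algebraMap R F x)⁻¹ = s / algebraMap R F x ^ (N + 1) * algebraMap R F r := by
      rw [← hN]; field_simp; ring
    rw [h1]
    exact hi.mul isIntegral_algebraMap
  have hex : ∃ n, ¬ IsIntegral R (s / algebraMap R F x ^ (n + 1)) := ⟨N, hbound⟩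
  classical
  have h1 := Nat.find_spec hex
  have h2 : IsIntegral R (s / algebraMap R F x ^ Nat.find hex) := by
    rcases hn : Nat.find hex with _ | n
    · simpa using hs
    · by_contra hcon
      exact Nat.find_min hex (by omega : n < Nat.find hex) hcon
  refine ⟨Nat.find hex, _, h2, (h.inv_or_div _ h2).resolve_right fun h3 => h1 ?_,
    (mul_div_cancel₀ _ (pow_ne_zero _ hx)).symm⟩
  rwa [div_div, ← pow_succ] at h3

theorem le_radical [IsLocalRing R] (h : IsTwistedDomain R F x) {a : R} (ha : a ≠ 0) :
    maximalIdeal R ≤ (Ideal.span {a}).radical := by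
  have haF : algebraMap R F a ≠ 0 := fun h0 =>
    ha (IsFractionRing.injective R F (by rw [h0, map_zero]))
  have hx : x ∈ (Ideal.span {a}).radical := by
    obtain ⟨n, r, hr⟩ := h.pow_mul_mem (algebraMap R F a)⁻¹
    refine ⟨n, Ideal.mem_span_singleton.mpr ⟨r, IsFractionRing.injective R F ?_⟩⟩
    rw [map_pow, map_mul, ← hr]
    field_simp
  intro r hr
  obtain ⟨c, -, hc⟩ := h.exists_mul_eq_mul hr hr
  refine Ideal.radical_isRadical _ ⟨2, ?_⟩
  rw [pow_two, hc]
  exact Ideal.mul_mem_right _ _ hx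

theorem ringKrullDim_eq_one [IsDomain R] (h : IsTwistedDomain R F x) : ringKrullDim R = 1 := by
  have := h.isLocalRing
  refine ringKrullDim_eq_one_iff_of_isLocalRing_isDomain.mpr ⟨fun hf => ?_, fun a ha =>
    h.le_radical ha⟩
  obtain ⟨y, hy⟩ := hf.mul_inv_cancel h.ne_zero
  exact h.not_isUnit (IsUnit.of_mul_eq_one _ hy)

/-- Choose a ∈ I of least value, so that a⁻¹I ⊆ V contains 1 and is a ring by the quadratic
relation. Then I² = aI, and evaluation at a makes I free of rank one over its endomorphism ring. -/
theorem isStableIdeal (h : IsTwistedDomain R F x) {I : Ideal R} (hI : I ≠ ⊥) :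
    IsStableIdeal I := by
  have hinj := IsFractionRing.injective R F
  have hx := h.algebraMap_ne_zero
  obtain ⟨a, haI, ha0, ha⟩ : ∃ a ∈ I, a ≠ 0 ∧
      ∀ b ∈ I, IsIntegral R (algebraMap R F b / algebraMap R F a) := by
    classical
    have hex : ∃ n : ℕ, ∃ b ∈ I, ∃ w : F, b ≠ 0 ∧ IsIntegral R w⁻¹ ∧
        algebraMap R F b = algebraMap R F x ^ n * w := by
      obtain ⟨b, hb, hb0⟩ := Submodule.exists_mem_ne_zero_of_ne_bot hI
      obtain ⟨n, w, -, hw, hbw⟩ := h.exists_eq_pow_mul (s := algebraMap R F b)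
        isIntegral_algebraMap fun h0 => hb0 (hinj (by rw [h0, map_zero]))
      exact ⟨n, b, hb, w, hb0, hw, hbw⟩
    obtain ⟨a, haI, w, ha0, hw, haw⟩ := Nat.find_spec hex
    refine ⟨a, haI, ha0, fun b hb => ?_⟩
    by_cases hb0 : b = 0
    · rw [hb0, map_zero, zero_div]; exact isIntegral_zero
    obtain ⟨n, w', hw', hw'', hbw⟩ := h.exists_eq_pow_mul (s := algebraMap R F b)
      isIntegral_algebraMap fun h0 => hb0 (hinj (by rw [h0, map_zero]))
    have hle : Nat.find hex ≤ n := Nat.find_min' hex ⟨b, hb, w', hb0, hw'', hbw⟩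
    obtain ⟨k, rfl⟩ := Nat.exists_eq_add_of_le hle
    have h1 : algebraMap R F b / algebraMap R F a = algebraMap R F x ^ k * w' * w⁻¹ := by
      rw [haw, hbw, pow_add, div_mul_eq_div_div, mul_assoc,
        mul_div_cancel_left₀ _ (pow_ne_zero _ hx), div_eq_mul_inv]
    rw [h1, ← map_pow]
    exact (isIntegral_algebraMap.mul hw').mul hw
  have haF : algebraMap R F a ≠ 0 := fun h0 => ha0 (hinj (by rw [h0, map_zero]))
  have hmul : ∀ b ∈ I, ∀ c ∈ I, ∃ d ∈ I, b * c = a * d := by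
    intro b hb c hc
    obtain ⟨p, q, r, hpqr⟩ := h.mul_eq _ _ (ha b hb) (ha c hc)
    refine ⟨p * a + q * b + r * c, add_mem (add_mem (Ideal.mul_mem_left _ _ haI)
      (Ideal.mul_mem_left _ _ hb)) (Ideal.mul_mem_left _ _ hc), hinj ?_⟩
    simp only [map_mul, map_add]
    field_simp at hpqr
    linear_combination hpqr
  have hcancel : ∀ {b c : R}, a * b = a * c → b = c := fun {b c} hbc =>
    hinj (mul_left_cancel₀ haF (by rw [← map_mul, ← map_mul, hbc]))
  let f : Module.End R I →ₗ[Module.End R I] I :=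
    LinearMap.toSpanSingleton (Module.End R I) I ⟨a, haI⟩
  have hf : Function.Bijective f := by
    constructor
    · intro y z hyz
      have hyz' : y ⟨a, haI⟩ = z ⟨a, haI⟩ := hyz
      refine LinearMap.ext fun p => Subtype.val_injective (hcancel ?_)
      have h1 := Ideal.mul_end_apply_comm y p ⟨a, haI⟩
      have h2 := Ideal.mul_end_apply_comm z p ⟨a, haI⟩
      rw [hyz'] at h1
      exact h1.trans h2.symm
    · intro b
      choose g hgI hg using fun c : I => hmul b b.2 c c.2
      refine ⟨{ toFun := fun c => ⟨g c, hgI c⟩, map_add' := ?_, map_smul' := ?_ }, ?_⟩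
      · intro c d
        refine Subtype.val_injective (hcancel ?_)
        change a * g (c + d) = a * (g c + g d)
        rw [mul_add, ← hg, ← hg, ← hg, Submodule.coe_add, mul_add]
      · intro r c
        refine Subtype.val_injective (hcancel ?_)
        change a * g (r • c) = a * (r * g c)
        rw [mul_left_comm, ← hg, ← hg, Submodule.coe_smul, smul_eq_mul, mul_left_comm]
      · refine Subtype.val_injective (hcancel ?_)
        change a * g ⟨a, haI⟩ = a * b
        rw [← hg, mul_comm]
  exact Module.Projective.of_equiv (LinearEquiv.ofBijective f hf)

/-- Nakayama's lemma: if V were finite, V = R + xV would give V = R. -/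
theorem not_hasFiniteNormalization [IsDomain R] (h : IsTwistedDomain R F x) :
    ¬ HasFiniteNormalization R := by
  have := h.isLocalRing
  rw [hasFiniteNormalization_iff R F]
  intro hfin
  obtain ⟨s, hs, hsR⟩ := h.exists_notMem
  have key : (⊤ : Submodule R (integralClosure R F)) ≤
      LinearMap.range (Algebra.linearMap R (integralClosure R F)) := by
    refine Submodule.le_of_le_smul_of_le_jacobson_bot (I := maximalIdeal R) Module.Finite.fg_top
      (IsLocalRing.maximalIdeal_le_jacobson _) ?_
    intro v _
    obtain ⟨r, w, hw, hv⟩ := h.eq_add_mul v v.2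
    have hv' : v = algebraMap R _ r + x • (⟨w, hw⟩ : integralClosure R F) :=
      Subtype.val_injective (by rw [hv, ← Algebra.smul_def]; rfl)
    rw [hv']
    exact Submodule.add_mem_sup ⟨r, rfl⟩
      (Submodule.smul_mem_smul h.not_isUnit Submodule.mem_top)
  obtain ⟨r, hr⟩ := key (Submodule.mem_top (x := ⟨s, hs⟩))
  exact hsR r (congrArg Subtype.val hr).symm

theorem isBadStableDomain [IsDomain R] (h : IsTwistedDomain R F x) : IsBadStableDomain R :=
  have := h.isLocalRing
  { stable := fun _ hI => h.isStableIdeal hI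
    krullDim_eq_one := h.ringKrullDim_eq_one
    not_finite := h.not_hasFiniteNormalization }

end IsTwistedDomain

/-- Cohen's theorem: in dimension one the maximal ideal is the only nonzero prime, so its finite
generation suffices. -/
theorem IsBadStableDomain.isNoetherianRing_iff {R : Type u} [CommRing R] [IsBadStableDomain R] :
    embDim R < ℵ₀ ↔ IsNoetherianRing R := by
  rw [embDim, Submodule.spanRank_finite_iff_fg]
  refine ⟨fun hfg => IsNoetherianRing.of_prime_ne_bot fun I hI hI0 => ?_, fun _ =>
    IsNoetherian.noetherian _⟩
  obtain ⟨a, haI, ha⟩ := Submodule.exists_mem_ne_zero_of_ne_bot hI0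
  have h1 := (ringKrullDim_eq_one_iff_of_isLocalRing_isDomain.mp
    (IsBadStableDomain.krullDim_eq_one (R := R))).2 a ha
  have h2 : IsLocalRing.maximalIdeal R ≤ I := h1.trans (hI.radical_le_iff.mpr
    ((Ideal.span_singleton_le_iff_mem I).mpr haI))
  rwa [← le_antisymm h2 (IsLocalRing.le_maximalIdeal hI.ne_top)]

/-! ### Rings between R and its integral closure -/

section Subalgebra

variable {R : Type u} {F : Type v} [CommRing R] [Field F] [Algebra R F]

theorem Subalgebra.isIntegral_iff_of_le_integralClosure {S : Subalgebra R F} (hS : S ≤ integralClosure R F) (y : F) :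
    IsIntegral S y ↔ IsIntegral R y := by
  refine ⟨fun h => ?_, fun h => h.tower_top⟩
  have : Algebra.IsIntegral R S := ⟨fun s => (isIntegral_algHom_iff S.val
    Subtype.val_injective).mp (hS s.2)⟩
  exact isIntegral_trans y h

variable [IsFractionRing R F]

theorem Subalgebra.isFractionRing_of_isFractionRing (S : Subalgebra R F) : IsFractionRing S F := by
  refine IsFractionRing.of_field S F fun z => ?_
  obtain ⟨p, q, -, rfl⟩ := IsFractionRing.div_surjective (A := R) z
  exact ⟨algebraMap R S p, algebraMap R S q, rfl⟩

/-- S and R have the same integral closure V, so every condition is inherited with the same x;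
properness of S is what gives an integral element outside S. -/
theorem IsTwistedDomain.of_subalgebra {x : R} (h : IsTwistedDomain R F x) {S : Subalgebra R F}
    (hS : S < integralClosure R F) : IsTwistedDomain S F (algebraMap R S x) := by
  have hint := fun y => Subalgebra.isIntegral_iff_of_le_integralClosure hS.le y
  refine ⟨fun h0 => h.algebraMap_ne_zero (congrArg Subtype.val h0), fun hu => ?_, fun s t hs ht => ?_,
    fun s hs => ?_, fun y => ?_, fun s hs => ?_, ?_⟩
  · obtain ⟨y, hy⟩ := hu.exists_right_inv
    refine h.not_isIntegral_inv ?_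
    have h1 : algebraMap R F x * (y : F) = 1 := congrArg Subtype.val hy
    rw [inv_eq_of_mul_eq_one_right h1]
    exact hS.le y.2
  · obtain ⟨a, b, c, habc⟩ := h.mul_eq s t ((hint s).mp hs) ((hint t).mp ht)
    exact ⟨algebraMap R S a, algebraMap R S b, algebraMap R S c, habc⟩
  · obtain ⟨r, w, hw, hs⟩ := h.eq_add_mul s ((hint s).mp hs)
    exact ⟨algebraMap R S r, w, (hint w).mpr hw, hs⟩
  · obtain ⟨n, r, hr⟩ := h.pow_mul_mem y
    exact ⟨n, algebraMap R S r, hr⟩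
  · rw [hint, hint]
    exact h.inv_or_div s ((hint s).mp hs)
  · obtain ⟨s, hs, hsS⟩ := SetLike.exists_of_lt hS
    exact ⟨s, (hint s).mpr hs, fun r hr => hsS (hr ▸ r.2)⟩

end Subalgebra

/-- A finite family of elements of the integral closure of `R` whose classes modulo `R` are
annihilated by `x` and linearly independent modulo the nonunits. -/
structure IsSocleIndependent (R : Type u) {F : Type v} [CommRing R] [Field F] [Algebra R F]
    (x : R) {j : ℕ} (v : Fin j → F) : Prop where
  isIntegral : ∀ i, IsIntegral R (v i)
  mul_mem : ∀ i, ∃ r, algebraMap R F x * v i = algebraMap R F r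
  not_isUnit : ∀ (c : Fin j → R) (r : R),
    ∑ i, algebraMap R F (c i) * v i = algebraMap R F r → ∀ i, ¬ IsUnit (c i)

/-! ### Embedding dimension and the socle of V/R -/

namespace IsTwistedDomain

open IsLocalRing

variable {R : Type u} {F : Type v} [CommRing R] [Field F] [Algebra R F] [IsFractionRing R F]
  {x : R}

/-- Elements of the integral closure modulo a submodule containing `R` are annihilated by every
element of `R` divisible, in the integral closure, by a power of `x` annihilating them. -/
theorem smul_mem_of_isIntegral_div (h : IsTwistedDomain R F x) {P : Submodule R F} (hP : 1 ∈ P)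
    {n : ℕ} {w : F} (hw : IsIntegral R w) (hxw : x ^ n • w ∈ P) {r : R}
    (hr : IsIntegral R (algebraMap R F r / algebraMap R F x ^ n)) : r • w ∈ P := by
  have hx := h.algebraMap_ne_zero
  obtain ⟨a, b, c, habc⟩ := h.mul_eq _ _ hr hw
  have h1 : r • w = (x ^ n * a + b * r) • (1 : F) + c • (x ^ n • w) := by
    simp only [Algebra.smul_def, map_mul, map_add, map_pow]
    field_simp at habc
    linear_combination habc
  rw [h1]
  exact add_mem (P.smul_mem _ hP) (P.smul_mem _ hxw)

/-- If the classes of the family span the socle of the integral closure modulo `R`, then the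
family yields a generating set of the maximal ideal. -/
theorem spanRank_le [IsLocalRing R] (h : IsTwistedDomain R F x) {j : ℕ} (v : Fin j → F)
    (hv : ∀ i, IsIntegral R (v i)) (hxv : ∀ i, ∃ r, algebraMap R F x * v i = algebraMap R F r)
    (hspan : ∀ w, IsIntegral R w → (∃ r, algebraMap R F x * w = algebraMap R F r) →
      ∃ (c : Fin j → R) (r : R), w = algebraMap R F r + ∑ i, algebraMap R F (c i) * v i) :
    (maximalIdeal R).spanRank ≤ (j + 1 : ℕ) := by
  have hx := h.algebraMap_ne_zero
  choose g hg using hxv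
  have hspan' : maximalIdeal R = Submodule.span R (insert x (Set.range g)) := by
    apply le_antisymm
    · intro r hr
      obtain ⟨c, d, hc⟩ := hspan _ ((h.mem_maximalIdeal_iff r).mp hr)
        ⟨r, mul_div_cancel₀ _ hx⟩
      have h1 : r = d * x + ∑ i, c i * g i := by
        refine IsFractionRing.injective R F ?_
        rw [div_eq_iff hx, add_mul, Finset.sum_mul] at hc
        rw [hc]
        simp only [map_add, map_mul, map_sum]
        congr 1
        exact Finset.sum_congr rfl fun i _ => by rw [← hg]; ring
      rw [h1]
      exact add_mem (Submodule.smul_mem _ _ (Submodule.subset_span (by simp)))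
        (Submodule.sum_mem _ fun i _ => Submodule.smul_mem _ _ (Submodule.subset_span (by simp)))
    · refine Submodule.span_le.mpr (Set.insert_subset h.not_isUnit ?_)
      rintro _ ⟨i, rfl⟩
      refine (h.mem_maximalIdeal_iff _).mpr ?_
      rw [← hg, mul_div_cancel_left₀ _ hx]
      exact hv i
  rw [hspan']
  refine (Submodule.spanRank_span_le_card _).trans (Cardinal.mk_insert_le.trans ?_)
  push_cast
  gcongr
  have := Cardinal.mk_range_le_lift (f := g)
  simpa using this

/-- As m² = xm, the elements x and x·vᵢ of m are linearly independent in the cotangent space; the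
extra 1 in the bound comes from x itself. -/
theorem le_spanRank [IsLocalRing R] (h : IsTwistedDomain R F x) {j : ℕ} {v : Fin j → F}
    (hv : IsSocleIndependent R x v) : ((j + 1 : ℕ) : Cardinal) ≤ (maximalIdeal R).spanRank := by
  have hx := h.algebraMap_ne_zero
  have hinj := IsFractionRing.injective R F
  by_cases hfg : Submodule.FG (maximalIdeal R)
  swap
  · rw [← Submodule.spanRank_finite_iff_fg, not_lt] at hfg
    exact (Cardinal.natCast_lt_aleph0).le.trans hfg
  have : IsDomain R := hinj.isDomain _
  have := h.isBadStableDomain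
  have : IsNoetherianRing R := IsBadStableDomain.isNoetherianRing_iff.mp
    (Submodule.spanRank_finite_iff_fg.mpr hfg)
  rw [hfg.spanRank_eq_spanFinrank, Nat.cast_le, spanFinrank_maximalIdeal_eq_finrank_cotangentSpace]
  choose g hg using hv.mul_mem
  have hgm : ∀ i, g i ∈ maximalIdeal R := fun i => by
    rw [h.mem_maximalIdeal_iff, ← hg, mul_div_cancel_left₀ _ hx]
    exact hv.isIntegral i
  let w : Fin (j + 1) → maximalIdeal R := Fin.cons ⟨x, h.not_isUnit⟩ fun i => ⟨g i, hgm i⟩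
  have hlin : LinearIndependent (ResidueField R) fun i => (maximalIdeal R).toCotangent (w i) := by
    rw [Fintype.linearIndependent_iff]
    intro c hc
    choose r hr using fun i => residue_surjective (c i)
    have h1 : (maximalIdeal R).toCotangent (∑ i, r i • w i) = 0 := by
      rw [map_sum, ← hc]
      refine Finset.sum_congr rfl fun i _ => ?_
      rw [map_smul, ← hr, ← ResidueField.algebraMap_eq]
      exact (algebraMap_smul (ResidueField R) (r i)
        ((maximalIdeal R).toCotangent (w i) : CotangentSpace R)).symm
    rw [Ideal.toCotangent_eq_zero] at h1
    have hsq : ∀ z ∈ maximalIdeal R ^ 2, ∃ d ∈ maximalIdeal R, z = x * d := by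
      intro z hz
      rw [pow_two] at hz
      induction hz using Submodule.mul_induction_on' with
      | mem_mul_mem a ha b hb => exact h.exists_mul_eq_mul ha hb
      | add a _ b _ ha hb =>
        obtain ⟨d, hd, rfl⟩ := ha
        obtain ⟨d', hd', rfl⟩ := hb
        exact ⟨d + d', add_mem hd hd', by ring⟩
    obtain ⟨d, hd, hsum⟩ := hsq _ h1
    rw [AddSubmonoidClass.coe_finsetSum, Fin.sum_univ_succ] at hsum
    have hsum' : r 0 * x + ∑ i, r (Fin.succ i) * g i = x * d := hsum
    have h2 : algebraMap R F (r 0) + ∑ i, algebraMap R F (r (Fin.succ i)) * v i =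
        algebraMap R F d := by
      apply mul_left_cancel₀ hx
      rw [← map_mul, ← hsum', mul_add, Finset.mul_sum]
      simp only [map_add, map_mul, map_sum, ← hg]
      rw [mul_comm]
      congr 1
      exact Finset.sum_congr rfl fun i _ => by ring
    have h3 : ∀ i, r (Fin.succ i) ∈ maximalIdeal R := by
      refine hv.not_isUnit (fun i => r (Fin.succ i)) (d - r 0) ?_
      rw [map_sub, ← h2]; ring
    -- Each product of the coefficient r(i+1) with gᵢ lies in m² = xm, so x can be cancelled from
    -- the relation, leaving r(0) ∈ m.
    have h4 : r 0 ∈ maximalIdeal R := by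
      choose e he hre using fun i => h.exists_mul_eq_mul (h3 i) (hgm i)
      have h5 : r 0 = d - ∑ i, e i := by
        apply hinj
        apply mul_left_cancel₀ hx
        have h6 := congrArg (algebraMap R F) hsum'
        simp only [hre, ← Finset.mul_sum, map_add, map_mul] at h6
        rw [map_sub]
        linear_combination h6
      rw [h5]
      exact sub_mem hd (Ideal.sum_mem _ fun i _ => he i)
    intro i
    rw [← hr, residue_eq_zero_iff]
    refine Fin.cases h4 h3 i
  simpa using hlin.fintype_card_le_finrank

/-- A bound on the sizes of the socle-independent families bounds the embedding dimension. -/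
theorem spanRank_le_of_forall_le [IsLocalRing R] (h : IsTwistedDomain R F x) {q : ℕ}
    (hq : ∀ (j : ℕ) (v : Fin j → F), IsSocleIndependent R x v → j ≤ q) :
    (maximalIdeal R).spanRank ≤ (q + 1 : ℕ) := by
  obtain ⟨j, ⟨v, hv⟩, hmax⟩ : ∃ j : ℕ, (∃ v : Fin j → F, IsSocleIndependent R x v) ∧
      ∀ v : Fin (j + 1) → F, ¬ IsSocleIndependent R x v := by
    by_contra! hcon
    have : ∀ j : ℕ, ∃ v : Fin j → F, IsSocleIndependent R x v := by
      intro j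
      induction j with
      | zero => exact ⟨Fin.elim0, fun i => i.elim0, fun i => i.elim0, fun _ _ _ i => i.elim0⟩
      | succ j ih => exact hcon j ih
    obtain ⟨v, hv⟩ := this (q + 1)
    have := hq _ v hv
    omega
  refine (h.spanRank_le v hv.isIntegral hv.mul_mem fun w hw hxw => ?_).trans
    (Nat.cast_le.mpr (Nat.succ_le_succ (hq j v hv)))
  by_contra! hcon
  -- A new socle element w outside the span would enlarge the maximal family: its coefficient cannot
  -- be a unit, and a nonunit multiple of w lies in R.
  refine hmax (Fin.cons w v) ⟨Fin.cases hw hv.isIntegral, Fin.cases hxw hv.mul_mem, ?_⟩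
  intro c r hc
  rw [Fin.sum_univ_succ] at hc
  simp only [Fin.cons_zero, Fin.cons_succ] at hc
  have h0 : ¬ IsUnit (c 0) := by
    intro hu
    obtain ⟨d, hd⟩ := hu.exists_right_inv
    refine hcon (fun i => -(d * c (Fin.succ i))) (d * r) ?_
    have hd' := congrArg (algebraMap R F) hd
    simp only [map_mul, map_one] at hd'
    simp only [map_neg, map_mul, neg_mul, Finset.sum_neg_distrib, mul_assoc, ← Finset.mul_sum]
    rw [← hc]
    linear_combination -w * hd'
  refine Fin.cases h0 ?_
  have h1 := (h.not_isUnit_iff (c 0)).mp h0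
  obtain ⟨r', hr'⟩ := hxw
  have h2 := h.smul_mem_of_isIntegral_div (P := LinearMap.range (Algebra.linearMap R F)) (n := 1)
    ⟨1, by simp⟩ hw ⟨r', by simp [Algebra.smul_def, hr']⟩ (by simpa using h1)
  obtain ⟨e, he⟩ := h2
  rw [Algebra.linearMap_apply, Algebra.smul_def] at he
  exact hv.not_isUnit (fun i => c (Fin.succ i)) (r - e) (by rw [map_sub, ← hc, he]; ring)

end IsTwistedDomain

/-! ### Lengths of kernels, cokernels and residue spaces -/

section Length

open IsLocalRing

theorem LinearMap.length_le_length_ker_add {R : Type*} {M N : Type*} [Ring R] [AddCommGroup M]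
    [Module R M] [AddCommGroup N] [Module R N] (f : M →ₗ[R] N) :
    Module.length R M ≤ Module.length R (ker f) + Module.length R N := by
  rw [Module.length_eq_add_of_exact (ker f).subtype f.rangeRestrict (Submodule.subtype_injective _)
    f.surjective_rangeRestrict (by
      rw [LinearMap.exact_iff, f.ker_rangeRestrict, Submodule.range_subtype])]
  gcongr
  exact Module.length_le_of_injective (range f).subtype (Submodule.subtype_injective _)

/-- A nilpotent endomorphism of a module with kernel of finite length has kernel and cokernel of
the same length. -/
theorem LinearMap.length_coker_le_length_ker {R : Type*} {M : Type*} [Ring R] [AddCommGroup M]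
    [Module R M] (f : M →ₗ[R] M) {q n : ℕ} (hq : Module.length R (ker f) ≤ q) (hn : f ^ n = 0) :
    Module.length R (M ⧸ range f) ≤ q := by
  have key : ∀ k : ℕ, Module.length R (ker (f ^ k)) ≤ (k * q : ℕ) := by
    intro k
    induction k with
    | zero =>
      have : Subsingleton (ker (f ^ 0)) := by
        rw [pow_zero, Module.End.one_eq_id, LinearMap.ker_id]; infer_instance
      rw [Module.length_eq_zero]
      simp
    | succ k ih =>
      let g : ker (f ^ (k + 1)) →ₗ[R] ker (f ^ k) :=
        f.restrict fun z hz => by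
          rw [LinearMap.mem_ker, pow_succ, Module.End.mul_apply] at hz
          exact hz
      have hg : Module.length R (ker g) ≤ Module.length R (ker f) := by
        let i : ker g →ₗ[R] ker f :=
          ((ker (f ^ (k + 1))).subtype ∘ₗ (ker g).subtype).codRestrict (ker f) fun z =>
            congrArg Subtype.val z.2
        refine Module.length_le_of_injective i fun a b hab => ?_
        have h1 := congrArg Subtype.val hab
        exact Subtype.val_injective (Subtype.val_injective h1)
      calc Module.length R (ker (f ^ (k + 1)))
          ≤ Module.length R (ker g) + Module.length R (ker (f ^ k)) := g.length_le_length_ker_add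
        _ ≤ q + (k * q : ℕ) := add_le_add (hg.trans hq) ih
        _ = ((k + 1) * q : ℕ) := by push_cast; ring
  -- Nilpotency makes M the kernel of some power of f, hence of finite length. The length of the
  -- range may then be cancelled from ker + range = range + coker.
  have hfin : Module.length R M ≠ ⊤ := by
    have h1 := key n
    rw [hn, LinearMap.ker_zero, Module.length_top] at h1
    exact ne_top_of_le_ne_top (ENat.natCast_ne_top _) h1
  have h1 := Module.length_eq_add_of_exact (ker f).subtype f.rangeRestrict
    (Submodule.subtype_injective _) f.surjective_rangeRestrict (by
      rw [LinearMap.exact_iff, f.ker_rangeRestrict, Submodule.range_subtype])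
  have h2 := Module.length_eq_add_of_exact (range f).subtype (range f).mkQ
    (Submodule.subtype_injective _) (Submodule.mkQ_surjective _)
    (LinearMap.exact_subtype_mkQ _)
  have h3 : Module.length R (range f) ≠ ⊤ := by
    intro h
    rw [h, top_add] at h2
    exact hfin h2
  rw [h1, add_comm] at h2
  rw [← (ENat.addLECancellable_of_ne_top h3).inj.mp h2]
  exact hq

variable {R : Type*} {N : Type*} [CommRing R] [IsLocalRing R] [AddCommGroup N] [Module R N]

theorem exists_linearMap_of_smul_eq_zero {j : ℕ} (w : Fin j → N)
    (hw : ∀ i, ∀ r ∈ maximalIdeal R, r • w i = 0) :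
    ∃ g : (Fin j → R ⧸ maximalIdeal R) →ₗ[R] N,
      ∀ c : Fin j → R, g (fun i => Ideal.Quotient.mk _ (c i)) = ∑ i, c i • w i := by
  refine ⟨∑ i, (Submodule.liftQ (maximalIdeal R) (LinearMap.toSpanSingleton R N (w i))
    fun r hr => hw i r hr) ∘ₗ LinearMap.proj i, fun c => ?_⟩
  rw [LinearMap.sum_apply]
  rfl

theorem length_pi_residue (j : ℕ) : Module.length R (Fin j → R ⧸ maximalIdeal R) = j := by
  have : IsSimpleModule R (R ⧸ maximalIdeal R) :=
    isSimpleModule_iff_isCoatom.mpr (Ideal.isMaximal_def.mp inferInstance)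
  rw [Module.length_pi_of_fintype]
  simp [Module.length_eq_one]

theorem le_length_of_independent {j : ℕ} (w : Fin j → N)
    (hw : ∀ i, ∀ r ∈ maximalIdeal R, r • w i = 0)
    (hind : ∀ c : Fin j → R, ∑ i, c i • w i = 0 → ∀ i, c i ∈ maximalIdeal R) :
    j ≤ Module.length R N := by
  obtain ⟨g, hg⟩ := exists_linearMap_of_smul_eq_zero w hw
  rw [← length_pi_residue (R := R) j]
  refine Module.length_le_of_injective g ((injective_iff_map_eq_zero g).mpr fun c hc => ?_)
  choose r hr using fun i => Ideal.Quotient.mk_surjective (c i)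
  obtain rfl : (fun i => Ideal.Quotient.mk _ (r i)) = c := funext hr
  rw [hg] at hc
  exact funext fun i => Ideal.Quotient.eq_zero_iff_mem.mpr (hind r hc i)

theorem length_le_of_forall_independent_le (hN : ∀ r ∈ maximalIdeal R, ∀ z : N, r • z = 0) {q : ℕ}
    (hq : ∀ (j : ℕ) (w : Fin j → N),
      (∀ c : Fin j → R, ∑ i, c i • w i = 0 → ∀ i, c i ∈ maximalIdeal R) → j ≤ q) :
    Module.length R N ≤ q := by
  obtain ⟨j, ⟨w, hw⟩, hmax⟩ : ∃ j : ℕ,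
      (∃ w : Fin j → N, ∀ c : Fin j → R, ∑ i, c i • w i = 0 → ∀ i, c i ∈ maximalIdeal R) ∧
      ∀ w : Fin (j + 1) → N,
        ¬ ∀ c : Fin (j + 1) → R, ∑ i, c i • w i = 0 → ∀ i, c i ∈ maximalIdeal R := by
    by_contra! hcon
    have : ∀ j : ℕ, ∃ w : Fin j → N,
        ∀ c : Fin j → R, ∑ i, c i • w i = 0 → ∀ i, c i ∈ maximalIdeal R := by
      intro j
      induction j with
      | zero => exact ⟨Fin.elim0, fun _ _ i => i.elim0⟩
      | succ j ih =>
        obtain ⟨w, hw⟩ := hcon j ih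
        exact ⟨w, hw⟩
    obtain ⟨w, hw⟩ := this (q + 1)
    have := hq _ w hw
    omega
  obtain ⟨g, hg⟩ := exists_linearMap_of_smul_eq_zero w fun i r hr => hN r hr _
  refine le_trans ?_ (Nat.cast_le.mpr (hq j w hw))
  rw [← length_pi_residue (R := R) j]
  refine Module.length_le_of_surjective g fun z => ?_
  by_contra! hcon
  refine hmax (Fin.cons z w) fun c hc => ?_
  rw [Fin.sum_univ_succ] at hc
  simp only [Fin.cons_zero, Fin.cons_succ] at hc
  have h0 : c 0 ∈ maximalIdeal R := by
    by_contra hu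
    rw [notMem_maximalIdeal] at hu
    obtain ⟨d, hd⟩ := hu.exists_right_inv
    refine hcon (fun i => Ideal.Quotient.mk _ (-(d * c (Fin.succ i)))) ?_
    rw [hg]
    simp only [neg_smul, mul_smul, Finset.sum_neg_distrib, ← Finset.smul_sum]
    rw [← smul_neg, ← eq_neg_of_add_eq_zero_left hc, smul_smul, mul_comm, hd, one_smul]
  rw [hN _ h0, zero_add] at hc
  exact Fin.cases h0 (hw (fun i => c (Fin.succ i)) hc)

end Length

/-! ### The socle does not grow in larger rings -/

namespace IsTwistedDomain

open IsLocalRing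

variable {R : Type u} {F : Type v} [CommRing R] [Field F] [Algebra R F] [IsFractionRing R F]
  {x : R}

/-- Modulo a larger ring inside the integral closure, socle-independent families do not get
larger. -/
theorem le_of_isSocleIndependent (h : IsTwistedDomain R F x) {q : ℕ}
    (hq : ∀ (j : ℕ) (v : Fin j → F), IsSocleIndependent R x v → j ≤ q) {P : Submodule R F}
    (hP : 1 ∈ P) {j : ℕ} {v : Fin j → F} (hv : ∀ i, IsIntegral R (v i))
    (hxv : ∀ i, x • v i ∈ P)
    (hind : ∀ c : Fin j → R, ∑ i, c i • v i ∈ P → ∀ i, ¬ IsUnit (c i)) : j ≤ q := by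
  have := h.isLocalRing
  have hx := h.algebraMap_ne_zero
  let O : Submodule R F := LinearMap.range (Algebra.linearMap R F)
  have hO : (1 : F) ∈ O := ⟨1, by simp⟩
  have hOP : O ≤ P := by
    rintro _ ⟨r, rfl⟩
    rw [Algebra.linearMap_apply, Algebra.algebraMap_eq_smul_one]
    exact P.smul_mem r hP
  let L : Submodule R F := Submodule.span R (Set.range v)
  have hL : ∀ y ∈ L, IsIntegral R y := by
    intro y hy
    have : L ≤ Subalgebra.toSubmodule (integralClosure R F) := by
      refine Submodule.span_le.mpr ?_
      rintro _ ⟨i, rfl⟩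
      exact hv i
    exact this hy
  -- M is the image in V/R of the span L of the family. Multiplication by x on M is nilpotent with
  -- kernel of length at most q, hence so is the length of M/xM. The image of L modulo P is killed
  -- by x, so it is a quotient of M/xM, and it has length at least j.
  let M : Submodule R (F ⧸ O) := L.map O.mkQ
  let f : M →ₗ[R] M := LinearMap.lsmul R M x
  have hker : Module.length R (LinearMap.ker f) ≤ q := by
    have hlift : ∀ z : LinearMap.ker f, ∃ y ∈ L, O.mkQ y = ((z : M) : F ⧸ O) ∧ x • y ∈ O := by
      intro z
      obtain ⟨y, hy, hyz⟩ := (z : M).2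
      refine ⟨y, hy, hyz, ?_⟩
      have h1 : x • ((z : M) : F ⧸ O) = 0 := congrArg Subtype.val z.2
      rw [← hyz, ← map_smul] at h1
      exact (Submodule.Quotient.mk_eq_zero O).mp h1
    refine length_le_of_forall_independent_le ?_ ?_
    · intro r hr z
      obtain ⟨y, hy, hyz, hxy⟩ := hlift z
      refine Subtype.val_injective (Subtype.val_injective ?_)
      change r • ((z : M) : F ⧸ O) = 0
      rw [← hyz, ← map_smul]
      refine (Submodule.Quotient.mk_eq_zero O).mpr ?_
      exact h.smul_mem_of_isIntegral_div hO (n := 1) (hL y hy) (by simpa using hxy)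
        (by simpa using (h.mem_maximalIdeal_iff r).mp hr)
    · intro k w hw
      choose y hyL hyz hxy using fun i => hlift (w i)
      refine hq k y ⟨fun i => hL _ (hyL i), fun i => ?_, fun c r hc => hw c ?_⟩
      · obtain ⟨r, hr⟩ := hxy i
        exact ⟨r, by rw [← Algebra.smul_def, ← hr]; rfl⟩
      · refine Subtype.val_injective (Subtype.val_injective ?_)
        simp only [AddSubmonoidClass.coe_finsetSum, Submodule.coe_smul, ← hyz, ← map_smul, ← map_sum]
        refine (Submodule.Quotient.mk_eq_zero O).mpr ⟨r, ?_⟩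
        rw [Algebra.linearMap_apply, ← hc]
        simp only [Algebra.smul_def]
  obtain ⟨n, hn⟩ : ∃ n : ℕ, f ^ n = 0 := by
    choose n r hr using fun i => h.pow_mul_mem (v i)
    have hLO : L ≤ O.comap (LinearMap.lsmul R F (x ^ ∑ i, n i)) := by
      refine Submodule.span_le.mpr ?_
      rintro _ ⟨i, rfl⟩
      have hle : n i ≤ ∑ i, n i := Finset.single_le_sum (fun _ _ => Nat.zero_le _)
        (Finset.mem_univ i)
      obtain ⟨k, hk⟩ := Nat.exists_eq_add_of_le hle
      refine ⟨x ^ k * r i, ?_⟩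
      rw [LinearMap.lsmul_apply, hk, Algebra.smul_def, Algebra.linearMap_apply, map_mul, ← hr,
        map_pow, map_pow]
      ring
    refine ⟨∑ i, n i, LinearMap.ext fun z => ?_⟩
    have hf : ∀ k : ℕ, ∀ z : M, (f ^ k) z = x ^ k • z := by
      intro k
      induction k with
      | zero => intro z; simp
      | succ k ih =>
        intro z
        rw [pow_succ', Module.End.mul_apply, ih, pow_succ', mul_smul]
        rfl
    rw [hf]
    obtain ⟨_, y, hy, rfl⟩ := z
    refine Subtype.val_injective ?_
    change x ^ (∑ i, n i) • O.mkQ y = 0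
    rw [← map_smul]
    exact (Submodule.Quotient.mk_eq_zero O).mpr (hLO hy)
  have h1 := f.length_coker_le_length_ker hker hn
  let M' : Submodule R (F ⧸ P) := L.map P.mkQ
  let π : M →ₗ[R] M' := (Submodule.factor hOP).restrict (by
    rintro _ ⟨y, hy, rfl⟩
    exact ⟨y, hy, rfl⟩)
  have hxM' : ∀ z : M', x • z = 0 := by
    rintro ⟨_, y, hy, rfl⟩
    refine Subtype.val_injective ?_
    change x • P.mkQ y = 0
    rw [← map_smul]
    refine (Submodule.Quotient.mk_eq_zero P).mpr ?_
    have : L ≤ P.comap (LinearMap.lsmul R F x) := by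
      refine Submodule.span_le.mpr ?_
      rintro _ ⟨i, rfl⟩
      exact hxv i
    exact this hy
  have hπ : LinearMap.range f ≤ LinearMap.ker π := by
    rintro _ ⟨z, rfl⟩
    rw [LinearMap.mem_ker]
    change π (x • z) = 0
    rw [map_smul, hxM']
  have h2 : Module.length R M' ≤ Module.length R (M ⧸ LinearMap.range f) := by
    refine Module.length_le_of_surjective ((LinearMap.range f).liftQ π hπ) ?_
    rintro ⟨_, y, hy, rfl⟩
    exact ⟨Submodule.Quotient.mk ⟨O.mkQ y, y, hy, rfl⟩, rfl⟩
  have h3 : (j : ℕ∞) ≤ Module.length R M' := by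
    refine le_length_of_independent
      (fun i => (⟨P.mkQ (v i), v i, Submodule.subset_span ⟨i, rfl⟩, rfl⟩ : M')) ?_ ?_
    · intro i r hr
      refine Subtype.val_injective ?_
      change r • P.mkQ (v i) = 0
      rw [← map_smul]
      refine (Submodule.Quotient.mk_eq_zero P).mpr ?_
      exact h.smul_mem_of_isIntegral_div hP (n := 1) (hv i) (by simpa using hxv i)
        (by simpa using (h.mem_maximalIdeal_iff r).mp hr)
    · intro c hc
      refine hind c ?_
      have h4 := congrArg Subtype.val hc
      simp only [AddSubmonoidClass.coe_finsetSum, Submodule.coe_smul, ← map_smul, ← map_sum] at h4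
      exact (Submodule.Quotient.mk_eq_zero P).mp h4
  exact_mod_cast (h3.trans h2).trans h1

/-- Rings properly between `R` and its integral closure have at most the embedding dimension
of `R`. -/
theorem spanRank_maximalIdeal_subalgebra_le [IsLocalRing R] (h : IsTwistedDomain R F x) {n : ℕ}
    (hn : (maximalIdeal R).spanRank = n) {S : Subalgebra R F} (hS : S < integralClosure R F)
    [IsLocalRing S] : (maximalIdeal S).spanRank ≤ n := by
  have hSt := h.of_subalgebra hS
  have := S.isFractionRing_of_isFractionRing
  -- The empty family already gives n ≥ 1, so that the truncated n - 1 below satisfies (n - 1) + 1 =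
  -- n.
  have hpos : 1 ≤ n := by
    have := h.le_spanRank (v := Fin.elim0)
      ⟨fun i => i.elim0, fun i => i.elim0, fun _ _ _ i => i.elim0⟩
    rw [hn] at this
    exact_mod_cast this
  have hq : ∀ (j : ℕ) (v : Fin j → F), IsSocleIndependent R x v → j ≤ n - 1 := by
    intro j v hv
    have := h.le_spanRank hv
    rw [hn, Nat.cast_le] at this
    omega
  have hqS : ∀ (j : ℕ) (v : Fin j → F), IsSocleIndependent S (algebraMap R S x) v → j ≤ n - 1 := by
    intro j v hv
    refine h.le_of_isSocleIndependent hq (P := Subalgebra.toSubmodule S) S.one_mem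
      (fun i => (Subalgebra.isIntegral_iff_of_le_integralClosure hS.le _).mp (hv.isIntegral i))
      (fun i => ?_) fun c hc i => ?_
    · obtain ⟨r, hr⟩ := hv.mul_mem i
      rw [Algebra.smul_def]
      have h1 : algebraMap R F x * v i = (r : F) := hr
      rw [h1]
      exact r.2
    · have h1 := hv.not_isUnit (fun i => algebraMap R S (c i)) ⟨_, hc⟩ (by
        change ∑ i, algebraMap R F (c i) * v i = ∑ i, c i • v i
        simp only [Algebra.smul_def]) i
      exact fun hu => h1 (hu.map _)
  have h1 := hSt.spanRank_le_of_forall_le hqS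
  rwa [Nat.sub_add_cancel hpos] at h1

end IsTwistedDomain

/-! ### V/R as a direct sum of copies of F/V -/

namespace IsTwistedDomain

open IsLocalRing

variable {R : Type u} {F : Type v} [CommRing R] [Field F] [Algebra R F]
  {x : R}

variable (R) in
/-- The class of an element of the quotient field modulo the integral closure. -/
abbrev toQuotNormalization : F →ₗ[R] QuotNormalization R F :=
  (Subalgebra.toSubmodule (integralClosure R F)).mkQ

variable (R F) in
/-- The class of an element of the integral closure modulo `R`. -/
abbrev toQuotBase : integralClosure R F →ₗ[R] QuotBase R (integralClosure R F) :=
  (LinearMap.range (Algebra.linearMap R (integralClosure R F))).mkQ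

theorem toQuotNormalization_eq_zero_iff {y : F} : toQuotNormalization R y = 0 ↔ IsIntegral R y :=
  Submodule.Quotient.mk_eq_zero _

theorem toQuotBase_eq_zero_iff {w : integralClosure R F} :
    toQuotBase R F w = 0 ↔ ∃ r, (w : F) = algebraMap R F r := by
  refine (Submodule.Quotient.mk_eq_zero _).trans ⟨?_, ?_⟩
  · rintro ⟨r, rfl⟩
    exact ⟨r, rfl⟩
  · rintro ⟨r, hr⟩
    exact ⟨r, Subtype.val_injective hr.symm⟩

theorem exists_smul_quotBase_eq (h : IsTwistedDomain R F x)
    (d : QuotBase R (integralClosure R F)) : ∃ d', x • d' = d := by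
  obtain ⟨w, rfl⟩ := Submodule.mkQ_surjective _ d
  obtain ⟨r, w', hw', hrw⟩ := h.eq_add_mul w w.2
  refine ⟨toQuotBase R F ⟨w', hw'⟩, ?_⟩
  rw [← map_smul, ← sub_eq_zero, ← map_sub, toQuotBase_eq_zero_iff]
  refine ⟨-r, ?_⟩
  change x • w' - (w : F) = _
  rw [hrw, Algebra.smul_def, map_neg]
  ring

theorem exists_pow_smul_quotBase_eq_zero (h : IsTwistedDomain R F x)
    (d : QuotBase R (integralClosure R F)) : ∃ n : ℕ, x ^ n • d = 0 := by
  obtain ⟨w, rfl⟩ := Submodule.mkQ_surjective _ d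
  obtain ⟨n, r, hr⟩ := h.pow_mul_mem w
  refine ⟨n, ?_⟩
  rw [← map_smul, toQuotBase_eq_zero_iff]
  refine ⟨r, ?_⟩
  rw [← hr, ← map_pow, ← Algebra.smul_def]
  rfl

variable [IsFractionRing R F]

theorem exists_toQuotNormalization_eq (h : IsTwistedDomain R F x) (t : QuotNormalization R F) :
    ∃ (n : ℕ) (r : R), t = toQuotNormalization R (algebraMap R F r / algebraMap R F x ^ n) := by
  obtain ⟨y, rfl⟩ := Submodule.mkQ_surjective _ t
  obtain ⟨n, r, hr⟩ := h.pow_mul_mem y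
  exact ⟨n, r, by rw [← hr, mul_div_cancel_left₀ _ (pow_ne_zero n h.algebraMap_ne_zero)]⟩

/-- Since V = R + xV, the elements of x⁻¹V/V are represented by R-multiples of 1/x: the socle of F/V
is one-dimensional. -/
theorem exists_toQuotNormalization_eq_of_smul_eq_zero (h : IsTwistedDomain R F x)
    {t : QuotNormalization R F} (ht : x • t = 0) :
    ∃ r : R, t = toQuotNormalization R (algebraMap R F r / algebraMap R F x) := by
  have hx := h.algebraMap_ne_zero
  obtain ⟨y, rfl⟩ := Submodule.mkQ_surjective _ t
  rw [← map_smul] at ht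
  obtain ⟨r, w, hw, hrw⟩ := h.eq_add_mul _ (toQuotNormalization_eq_zero_iff.mp ht)
  refine ⟨r, ?_⟩
  rw [← sub_eq_zero, ← map_sub]
  refine toQuotNormalization_eq_zero_iff.mpr ?_
  have : y - algebraMap R F r / algebraMap R F x = w := by
    rw [Algebra.smul_def] at hrw
    field_simp
    linear_combination hrw
  rwa [this]

/-- This is what makes maps from F/V to V/R well defined: a fraction r/xⁿ in V has to act as zero on
elements killed by xⁿ. -/
theorem smul_quotBase_eq_zero (h : IsTwistedDomain R F x) {n : ℕ}
    {d : QuotBase R (integralClosure R F)} (hd : x ^ n • d = 0) {r : R}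
    (hr : IsIntegral R (algebraMap R F r / algebraMap R F x ^ n)) : r • d = 0 := by
  obtain ⟨w, rfl⟩ := Submodule.mkQ_surjective _ d
  rw [← map_smul, toQuotBase_eq_zero_iff] at hd ⊢
  obtain ⟨a, ha⟩ := hd
  obtain ⟨b, hb⟩ := h.smul_mem_of_isIntegral_div
    (P := LinearMap.range (Algebra.linearMap R F)) (w := (w : F)) ⟨1, by simp⟩ w.2 ⟨a, ha.symm⟩ hr
  exact ⟨b, hb.symm⟩

/-- An `x`-divisible sequence starting at `0` determines a linear map from the quotient field
modulo the integral closure. -/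
theorem exists_linearMap_quotNormalization (h : IsTwistedDomain R F x)
    {e : ℕ → QuotBase R (integralClosure R F)} (h0 : e 0 = 0) (hs : ∀ n, x • e (n + 1) = e n) :
    ∃ ψ : QuotNormalization R F →ₗ[R] QuotBase R (integralClosure R F),
      ∀ (n : ℕ) (r : R),
        ψ (toQuotNormalization R (algebraMap R F r / algebraMap R F x ^ n)) = r • e n := by
  have hx := h.algebraMap_ne_zero
  have hinj := IsFractionRing.injective R F
  have hpow : ∀ m n, x ^ m • e (n + m) = e n := by
    intro m
    induction m with
    | zero => intro n; simp
    | succ m ih =>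
      intro n
      rw [pow_succ, mul_smul, ← add_assoc, hs, ih]
  have hwd : ∀ (y : F) (n m : ℕ) (r r' : R), algebraMap R F x ^ n * y = algebraMap R F r →
      algebraMap R F x ^ m * y = algebraMap R F r' → r • e n = r' • e m := by
    intro y n m r r' hr hr'
    have h1 : r * x ^ m = r' * x ^ n := by
      apply hinj
      rw [map_mul, map_mul, ← hr, ← hr', map_pow, map_pow]
      ring
    rw [← hpow m n, ← hpow n m, smul_smul, smul_smul, h1, add_comm n m]
  choose N ρ hρ using h.pow_mul_mem
  let ψ₀ : F →ₗ[R] QuotBase R (integralClosure R F) :=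
    { toFun := fun y => ρ y • e (N y)
      map_add' := fun y z => by
        rw [← hpow (N z) (N y), ← hpow (N y) (N z), add_comm (N z), smul_smul, smul_smul,
          ← add_smul]
        refine hwd (y + z) _ _ _ _ (hρ _) ?_
        rw [map_add, map_mul, map_mul, ← hρ, ← hρ, map_pow, map_pow]
        ring
      map_smul' := fun a y => by
        rw [RingHom.id_apply, smul_smul]
        refine hwd (a • y) _ _ _ _ (hρ _) ?_
        rw [map_mul, ← hρ, Algebra.smul_def]
        ring }
  have hψ₀ : ∀ (n : ℕ) (r : R), ψ₀ (algebraMap R F r / algebraMap R F x ^ n) = r • e n :=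
    fun n r => hwd _ _ _ _ _ (hρ _) (mul_div_cancel₀ _ (pow_ne_zero n hx))
  refine ⟨Submodule.liftQ _ ψ₀ fun y hy => ?_, hψ₀⟩
  obtain ⟨n, r, hr⟩ := h.pow_mul_mem y
  have hy' : y = algebraMap R F r / algebraMap R F x ^ n := by
    rw [← hr, mul_div_cancel_left₀ _ (pow_ne_zero n hx)]
  rw [LinearMap.mem_ker, hy', hψ₀]
  refine h.smul_quotBase_eq_zero (n := n) ?_ (hy' ▸ hy)
  have := hpow n 0
  rwa [zero_add, h0] at this

/-- The integral closure modulo `R` is a direct sum of copies of the quotient field modulo the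
integral closure. -/
theorem exists_linearEquiv_quotBase (h : IsTwistedDomain R F x) :
    ∃ ι : Type v, Nonempty ((ι →₀ QuotNormalization R F) ≃ₗ[R]
      QuotBase R (integralClosure R F)) := by
  have := h.isLocalRing
  have hx := h.algebraMap_ne_zero
  let W := Submodule.torsionBySet R (QuotBase R (integralClosure R F)) (maximalIdeal R)
  let : Field (R ⧸ maximalIdeal R) := Ideal.Quotient.field _
  let b := Module.Basis.ofVectorSpace (R ⧸ maximalIdeal R) W
  have hW : ∀ d : QuotBase R (integralClosure R F), x • d = 0 → d ∈ W := by
    intro d hd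
    rw [Submodule.mem_torsionBySet_iff]
    rintro ⟨r, hr⟩
    exact h.smul_quotBase_eq_zero (n := 1) (by simpa using hd)
      (by simpa using (h.mem_maximalIdeal_iff r).mp hr)
  have hWx : ∀ d : W, x • (d : QuotBase R (integralClosure R F)) = 0 := fun d =>
    (Submodule.mem_torsionBySet_iff _ _).mp d.2 ⟨x, h.not_isUnit⟩
  choose div hdiv using h.exists_smul_quotBase_eq
  -- Divisibility extends each socle basis vector to a sequence 0, bᵢ, bᵢ/x, ..., which determines a
  -- map from F/V carrying the class of 1/x to bᵢ.
  obtain ⟨e, he0, he1, hes⟩ : ∃ e : Module.Basis.ofVectorSpaceIndex (R ⧸ maximalIdeal R) W → ℕ →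
      QuotBase R (integralClosure R F), (∀ i, e i 0 = 0) ∧ (∀ i, e i 1 = b i) ∧
        ∀ i n, x • e i (n + 1) = e i n := by
    refine ⟨fun i n => Nat.casesOn n 0 fun n => div^[n] (b i), fun _ => rfl, fun _ => rfl, ?_⟩
    intro i n
    cases n with
    | zero => exact hWx (b i)
    | succ n =>
      change x • div^[n + 1] _ = div^[n] _
      rw [Function.iterate_succ_apply', hdiv]
  have hepow : ∀ i n, x ^ n • e i (n + 1) = b i := by
    intro i n
    induction n with
    | zero => rw [pow_zero, one_smul, zero_add, he1]
    | succ n ih => rw [pow_succ, mul_smul, hes, ih]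
  choose ψ hψ using fun i => h.exists_linearMap_quotNormalization (he0 i) (hes i)
  let Ψ : (Module.Basis.ofVectorSpaceIndex (R ⧸ maximalIdeal R) W →₀ QuotNormalization R F) →ₗ[R]
    QuotBase R (integralClosure R F) := Finsupp.lsum ℕ ψ
  have hΨ : ∀ i t, Ψ (Finsupp.single i t) = ψ i t := fun i t => by
    simp [Ψ]
  have hspan : ∀ d : QuotBase R (integralClosure R F), x • d = 0 →
      ∃ (s : Finset (Module.Basis.ofVectorSpaceIndex (R ⧸ maximalIdeal R) W)) (c : _ → R),
        d = ∑ i ∈ s, c i • (b i : QuotBase R (integralClosure R F)) := by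
    intro d hd
    choose c hc using fun i => Ideal.Quotient.mk_surjective (b.repr ⟨d, hW d hd⟩ i)
    refine ⟨(b.repr ⟨d, hW d hd⟩).support, c, ?_⟩
    have h1 := b.linearCombination_repr ⟨d, hW d hd⟩
    rw [Finsupp.linearCombination_apply, Finsupp.sum] at h1
    have h2 := congrArg Subtype.val h1
    rw [AddSubmonoidClass.coe_finsetSum] at h2
    refine h2.symm.trans (Finset.sum_congr rfl fun i _ => ?_)
    rw [← hc]
    rfl
  have htors : ∀ f : Module.Basis.ofVectorSpaceIndex (R ⧸ maximalIdeal R) W →₀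
      QuotNormalization R F, ∃ n : ℕ, x ^ n • f = 0 := by
    intro f
    induction f using Finsupp.induction_linear with
    | zero => exact ⟨0, smul_zero _⟩
    | add f g hf hg =>
      obtain ⟨n, hn⟩ := hf
      obtain ⟨m, hm⟩ := hg
      refine ⟨n + m, ?_⟩
      rw [smul_add, pow_add, mul_comm, mul_smul, hn, mul_comm, mul_smul, hm, smul_zero, smul_zero,
        add_zero]
    | single i t =>
      obtain ⟨n, r, rfl⟩ := h.exists_toQuotNormalization_eq t
      refine ⟨n, ?_⟩
      rw [Finsupp.smul_single, ← map_smul, Algebra.smul_def, map_pow,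
        mul_div_cancel₀ _ (pow_ne_zero n hx), toQuotNormalization_eq_zero_iff.mpr
        isIntegral_algebraMap, Finsupp.single_zero]
  -- Injectivity need only be tested on the kernel of x, as everything is x-power torsion; there it
  -- is the linear independence of the bᵢ over R/m.
  have hsoc : ∀ f : Module.Basis.ofVectorSpaceIndex (R ⧸ maximalIdeal R) W →₀
      QuotNormalization R F, x • f = 0 → Ψ f = 0 → f = 0 := by
    intro f hf hΨf
    have hfi : ∀ i, x • f i = 0 := fun i => by
      rw [← Finsupp.smul_apply, hf, Finsupp.zero_apply]
    choose r hr using fun i => h.exists_toQuotNormalization_eq_of_smul_eq_zero (hfi i)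
    have h1 : ∑ i ∈ f.support, r i • b i = 0 := by
      refine Subtype.val_injective ?_
      rw [AddSubmonoidClass.coe_finsetSum, Submodule.coe_zero, ← hΨf]
      conv_rhs => rw [← f.sum_single, Finsupp.sum, map_sum]
      refine Finset.sum_congr rfl fun i _ => ?_
      rw [hΨ, hr, ← pow_one (algebraMap R F x), hψ, he1]
      rfl
    have h2 := linearIndependent_iff'.mp b.linearIndependent f.support
      (fun i => Ideal.Quotient.mk _ (r i)) h1
    ext i
    by_cases hi : i ∈ f.support
    · rw [hr, Finsupp.zero_apply, toQuotNormalization_eq_zero_iff, ← h.mem_maximalIdeal_iff]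
      exact Ideal.Quotient.eq_zero_iff_mem.mp (h2 i hi)
    · rw [Finsupp.notMem_support_iff.mp hi, Finsupp.zero_apply]
  have hinj : ∀ (n : ℕ) (f : Module.Basis.ofVectorSpaceIndex (R ⧸ maximalIdeal R) W →₀
      QuotNormalization R F), x ^ n • f = 0 → Ψ f = 0 → f = 0 := by
    intro n
    induction n with
    | zero => intro f hf _; simpa using hf
    | succ n ih =>
      intro f hf hΨf
      refine ih f (hsoc _ ?_ ?_) hΨf
      · rw [smul_smul, ← pow_succ', hf]
      · rw [map_smul, hΨf, smul_zero]
  have hsurj : ∀ (n : ℕ) (d : QuotBase R (integralClosure R F)), x ^ n • d = 0 →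
      d ∈ LinearMap.range Ψ := by
    intro n
    induction n with
    | zero =>
      intro d hd
      rw [pow_zero, one_smul] at hd
      rw [hd]
      exact zero_mem _
    | succ n ih =>
      intro d hd
      obtain ⟨s, c, hsc⟩ := hspan (x ^ n • d) (by rw [smul_smul, ← pow_succ', hd])
      have h1 : ∑ i ∈ s, c i • e i (n + 1) ∈ LinearMap.range Ψ := by
        refine Submodule.sum_mem _ fun i _ => ?_
        rw [← hψ, ← hΨ]
        exact LinearMap.mem_range_self _ _
      -- The socle element xⁿd = ∑ cᵢbᵢ equals xⁿ∑ cᵢeᵢ(n+1), so the difference is killed by xⁿ and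
      -- induction applies.
      have h2 : d - ∑ i ∈ s, c i • e i (n + 1) ∈ LinearMap.range Ψ := by
        refine ih _ ?_
        rw [smul_sub, hsc, Finset.smul_sum, sub_eq_zero]
        refine Finset.sum_congr rfl fun i _ => ?_
        rw [smul_comm, hepow]
      simpa using add_mem h2 h1
  refine ⟨_, ⟨LinearEquiv.ofBijective Ψ ⟨?_, ?_⟩⟩⟩
  · refine (injective_iff_map_eq_zero Ψ).mpr fun f hf => ?_
    obtain ⟨n, hn⟩ := htors f
    exact hinj n f hn hf
  · intro d
    obtain ⟨n, hn⟩ := h.exists_pow_smul_quotBase_eq_zero d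
    exact hsurj n d hn

end IsTwistedDomain

/-! ### Rings of prescribed embedding dimension -/

namespace IsTwistedDomain

open IsLocalRing

variable {R : Type u} {F : Type v} [CommRing R] [Field F] [Algebra R F] {x : R}

/-- Every submodule of the integral closure modulo `R` is of the form `S / R` for a ring `S`. -/
theorem exists_subalgebra (h : IsTwistedDomain R F x)
    (P : Submodule R (QuotBase R (integralClosure R F))) :
    ∃ S : Subalgebra R F, S ≤ integralClosure R F ∧
      (∀ w : integralClosure R F, (w : F) ∈ S ↔ toQuotBase R F w ∈ P) ∧
      Nonempty (QuotBase R S ≃ₗ[R] P) := by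
  have hR : ∀ (r : R) (hr : IsIntegral R (algebraMap R F r)),
      toQuotBase R F ⟨algebraMap R F r, hr⟩ = 0 := fun r hr =>
    toQuotBase_eq_zero_iff.mpr ⟨r, rfl⟩
  let S : Subalgebra R F :=
    { carrier := {y | ∃ hy : IsIntegral R y, toQuotBase R F ⟨y, hy⟩ ∈ P}
      mul_mem' := by
        rintro y z ⟨hy, hyP⟩ ⟨hz, hzP⟩
        refine ⟨hy.mul hz, ?_⟩
        obtain ⟨a, b, c, habc⟩ := h.mul_eq y z hy hz
        have h1 : (⟨y * z, hy.mul hz⟩ : integralClosure R F) =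
            algebraMap R (integralClosure R F) a + b • ⟨y, hy⟩ + c • ⟨z, hz⟩ := by
          refine Subtype.val_injective (habc.trans ?_)
          rw [← Algebra.smul_def, ← Algebra.smul_def]
          rfl
        rw [h1, map_add, map_add, map_smul, map_smul, toQuotBase_eq_zero_iff.mpr ⟨a, rfl⟩, zero_add]
        exact add_mem (P.smul_mem b hyP) (P.smul_mem c hzP)
      add_mem' := by
        rintro y z ⟨hy, hyP⟩ ⟨hz, hzP⟩
        exact ⟨hy.add hz, add_mem hyP hzP⟩
      algebraMap_mem' := fun r =>
        ⟨isIntegral_algebraMap, by rw [hR]; exact zero_mem _⟩ }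
  have hSV : S ≤ integralClosure R F := fun y hy => hy.1
  have hmem : ∀ w : integralClosure R F, (w : F) ∈ S ↔ toQuotBase R F w ∈ P := fun w =>
    ⟨fun hw => hw.2, fun hw => ⟨w.2, hw⟩⟩
  refine ⟨S, hSV, hmem, ⟨?_⟩⟩
  let f : S →ₗ[R] QuotBase R (integralClosure R F) :=
    toQuotBase R F ∘ₗ (Subalgebra.inclusion hSV).toLinearMap
  have hker : LinearMap.ker f = LinearMap.range (Algebra.linearMap R S) := by
    ext s
    rw [LinearMap.mem_ker]
    refine toQuotBase_eq_zero_iff.trans ⟨?_, ?_⟩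
    · rintro ⟨r, hr⟩
      exact ⟨r, Subtype.val_injective hr.symm⟩
    · rintro ⟨r, rfl⟩
      exact ⟨r, rfl⟩
  have hrange : LinearMap.range f = P := by
    ext d
    constructor
    · rintro ⟨s, rfl⟩
      exact s.2.2
    · intro hd
      obtain ⟨w, rfl⟩ := Submodule.mkQ_surjective _ d
      exact ⟨⟨w, (hmem w).mpr hd⟩, rfl⟩
  exact (Submodule.quotEquivOfEq _ _ hker.symm).trans
    (f.quotKerEquivRange.trans (LinearEquiv.ofEq _ _ hrange))

variable [IsFractionRing R F]

/-- S/R is taken to be the sum of all but k - 1 of the summands F/V of V/R. Then V/S has a socle of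
dimension k - 1. -/
theorem exists_subalgebra_spanRank_eq [IsLocalRing R] (h : IsTwistedDomain R F x) {k : ℕ}
    (hk : 2 ≤ k) (hkR : (k : Cardinal) ≤ (maximalIdeal R).spanRank) :
    ∃ S : Subalgebra R F, S < integralClosure R F ∧
      (∃ _ : IsLocalRing S, (maximalIdeal S).spanRank = k) ∧
      ∃ I : Type v, Nonempty (QuotBase R S ≃ₗ[R] ⨁ _ : I, QuotNormalization R F) := by
  classical
  have hx := h.algebraMap_ne_zero
  -- From here on `k` is the number of omitted summands, one less than the embedding dimension
  -- sought.
  obtain ⟨k, rfl⟩ : ∃ l, k = l + 1 := ⟨k - 1, by omega⟩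
  obtain ⟨ι, ⟨Ψ⟩⟩ := h.exists_linearEquiv_quotBase
  -- the socle of the direct sum
  let t : R → QuotNormalization R F := fun r =>
    toQuotNormalization R (algebraMap R F r / algebraMap R F x)
  have htr : ∀ r, r • t 1 = t r := fun r => by
    rw [← map_smul, Algebra.smul_def, map_one, mul_one_div]
  have htx : ∀ r, x • t r = 0 := fun r => by
    rw [← map_smul, Algebra.smul_def, mul_div_cancel₀ _ hx]
    exact toQuotNormalization_eq_zero_iff.mpr isIntegral_algebraMap
  choose v hv using fun i => Submodule.mkQ_surjective _ (Ψ (Finsupp.single i (t 1)))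
  have hvx : ∀ i, ∃ r, algebraMap R F x * (v i : F) = algebraMap R F r := by
    intro i
    have h1 : toQuotBase R F (x • v i) = 0 := by
      rw [map_smul, hv, ← map_smul, Finsupp.smul_single, htx, Finsupp.single_zero, map_zero]
    obtain ⟨r, hr⟩ := toQuotBase_eq_zero_iff.mp h1
    exact ⟨r, by rw [← hr, ← Algebra.smul_def]; rfl⟩
  have hsum : ∀ (m : ℕ) (g : Fin m ↪ ι) (c : Fin m → R),
      toQuotBase R F (∑ i, c i • v (g i)) = Ψ (∑ i, Finsupp.single (g i) (t (c i))) := by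
    intro m g c
    rw [map_sum, map_sum]
    refine Finset.sum_congr rfl fun i _ => ?_
    rw [map_smul, hv, ← map_smul, Finsupp.smul_single, htr]
  have happ : ∀ (m : ℕ) (g : Fin m ↪ ι) (c : Fin m → R) (i : Fin m),
      (∑ i, Finsupp.single (g i) (t (c i))) (g i) = t (c i) := by
    intro m g c i
    rw [Finsupp.finsetSum_apply, Finset.sum_eq_single i]
    · exact Finsupp.single_eq_same
    · intro j _ hji
      exact Finsupp.single_eq_of_ne fun hgj => hji (g.injective hgj.symm)
    · intro hi
      exact absurd (Finset.mem_univ i) hi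
  -- the socle of the integral closure modulo a submodule of finite support complement
  have hsoc : ∀ (m : ℕ) (g : Fin m ↪ ι) (d : QuotBase R (integralClosure R F)),
      x • d ∈ (Finsupp.supported _ R (Set.range g)ᶜ).map Ψ.toLinearMap →
      ∃ c : Fin m → R, d - toQuotBase R F (∑ i, c i • v (g i)) ∈
        (Finsupp.supported _ R (Set.range g)ᶜ).map Ψ.toLinearMap := by
    rintro m g d ⟨f, hf, hfd⟩
    have hfd' : x • Ψ.symm d = f := by
      rw [← map_smul, ← hfd]
      exact Ψ.symm_apply_apply f
    have h1 : ∀ i, x • (Ψ.symm d) (g i) = 0 := fun i => by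
      rw [← Finsupp.smul_apply, hfd']
      exact (Finsupp.mem_supported' R f).mp hf _ (by simp)
    choose c hc using fun i => h.exists_toQuotNormalization_eq_of_smul_eq_zero (h1 i)
    refine ⟨c, Ψ.symm d - ∑ i, Finsupp.single (g i) (t (c i)), ?_, ?_⟩
    · refine (Finsupp.mem_supported' R _).mpr fun a ha => ?_
      rw [Set.notMem_compl_iff] at ha
      obtain ⟨i, rfl⟩ := ha
      rw [Finsupp.sub_apply, happ, hc, sub_self]
    · rw [hsum]
      simp
  -- If there were fewer than k summands, the socle generators vᵢ would bound the embedding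
  -- dimension of R by |ι| + 1 < k + 1.
  obtain ⟨g⟩ : Nonempty (Fin k ↪ ι) := by
    by_cases hfin : Finite ι
    swap
    · rw [not_finite_iff_infinite] at hfin
      exact ⟨Fin.valEmbedding.trans (Infinite.natEmbedding ι)⟩
    have := Fintype.ofFinite ι
    refine Function.Embedding.nonempty_of_card_le ?_
    rw [Fintype.card_fin]
    let g : Fin (Fintype.card ι) ↪ ι := (Fintype.equivFin ι).symm.toEmbedding
    have h1 := h.spanRank_le (fun i => (v (g i) : F)) (fun i => (v (g i)).2) (fun i => hvx _) (by
      rintro w hw ⟨r, hr⟩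
      have h2 : toQuotBase R F (x • ⟨w, hw⟩) = 0 := toQuotBase_eq_zero_iff.mpr
        ⟨r, by rw [← hr, ← Algebra.smul_def]; rfl⟩
      obtain ⟨c, hc⟩ := hsoc _ g (toQuotBase R F ⟨w, hw⟩) (by
        rw [← map_smul, h2]; exact zero_mem _)
      have h3 : (Set.range g)ᶜ = ∅ := by
        rw [Set.compl_empty_iff]
        exact (Fintype.equivFin ι).symm.surjective.range_eq
      rw [h3, Finsupp.supported_empty, Submodule.map_bot, Submodule.mem_bot, ← map_sub,
        toQuotBase_eq_zero_iff] at hc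
      obtain ⟨r', hr'⟩ := hc
      refine ⟨c, r', ?_⟩
      rw [← hr', AddSubgroupClass.coe_sub, AddSubmonoidClass.coe_finsetSum]
      simp only [← Algebra.smul_def]
      exact (sub_add_cancel _ _).symm)
    have h2 := hkR.trans h1
    rw [Nat.cast_le] at h2
    omega
  obtain ⟨S, hSV, hmem, ⟨e⟩⟩ := h.exists_subalgebra
    ((Finsupp.supported _ R (Set.range g)ᶜ).map Ψ.toLinearMap)
  have hsupp : ∀ c : Fin k → R, (∑ i, c i • (v (g i) : F)) ∈ S →
      ∀ i, c i ∈ maximalIdeal R := by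
    intro c hc i
    have h1 : (∑ i, c i • (v (g i) : F)) = ((∑ i, c i • v (g i) : integralClosure R F) : F) := by
      rw [AddSubmonoidClass.coe_finsetSum]; rfl
    rw [h1, hmem, hsum] at hc
    obtain ⟨f, hf, hfc⟩ := hc
    have hfc' := Ψ.injective hfc
    rw [h.mem_maximalIdeal_iff]
    refine toQuotNormalization_eq_zero_iff.mp ?_
    change t (c i) = 0
    rw [← happ k g c i, ← hfc']
    exact (Finsupp.mem_supported' R f).mp hf _ (by simp)
  -- Here k ≥ 1 matters: with an omitted summand available, the sum of its socle generators is
  -- integral but not in S.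
  have hS : S < integralClosure R F := by
    refine lt_of_le_of_ne hSV fun heq => ?_
    have h1 := hsupp (fun _ => 1) (by
      rw [heq]
      exact sum_mem fun i _ => Subalgebra.smul_mem _ (v (g i)).2 1) ⟨0, by omega⟩
    exact (Ideal.ne_top_iff_one _).mp (maximalIdeal.isMaximal R).ne_top h1
  have hSt := h.of_subalgebra hS
  have := S.isFractionRing_of_isFractionRing
  have hSint := fun y => Subalgebra.isIntegral_iff_of_le_integralClosure hS.le y
  have hSloc := hSt.isLocalRing
  refine ⟨S, hS, ⟨hSloc, le_antisymm ?_ ?_⟩, ((Set.range g)ᶜ : Set ι), ⟨?_⟩⟩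
  · refine hSt.spanRank_le (fun i => (v (g i) : F)) (fun i => (hSint _).mpr (v (g i)).2)
      (fun i => ?_) ?_
    · obtain ⟨r, hr⟩ := hvx (g i)
      exact ⟨algebraMap R S r, hr⟩
    · rintro w hw ⟨s, hs⟩
      have hw' := (hSint w).mp hw
      obtain ⟨c, hc⟩ := hsoc k g (toQuotBase R F ⟨w, hw'⟩) (by
        rw [← map_smul, ← hmem]
        change x • w ∈ S
        rw [Algebra.smul_def]
        have h1 : algebraMap R F x * w = (s : F) := hs
        rw [h1]
        exact s.2)
      rw [← map_sub, ← hmem] at hc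
      refine ⟨fun i => algebraMap R S (c i), ⟨_, hc⟩, ?_⟩
      change w = (w - ((∑ i, c i • v (g i) : integralClosure R F) : F)) +
        ∑ i, algebraMap R F (c i) * (v (g i) : F)
      rw [AddSubmonoidClass.coe_finsetSum]
      simp only [← Algebra.smul_def]
      exact (sub_add_cancel _ _).symm
  · refine hSt.le_spanRank (v := fun i => (v (g i) : F)) ⟨fun i => (hSint _).mpr (v (g i)).2,
      fun i => ?_, fun c s hc i => ?_⟩
    · obtain ⟨r, hr⟩ := hvx (g i)
      exact ⟨algebraMap R S r, hr⟩
    -- Independence is known for coefficients in R. Writing cᵢ = rᵢ + xwᵢ reduces to them: cᵢ - rᵢ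
    -- is a nonunit of S, so it carries the socle element vᵢ into S.
    · choose r w hw hrw using fun i => h.eq_add_mul (c i : F) (hSV (c i).2)
      have hcr : ∀ i, IsIntegral S (algebraMap S F (c i - algebraMap R S (r i)) /
          algebraMap S F (algebraMap R S x)) := by
        intro i
        have h1 : algebraMap S F (c i - algebraMap R S (r i)) /
            algebraMap S F (algebraMap R S x) = w i := by
          change ((c i : F) - algebraMap R F (r i)) / algebraMap R F x = w i
          rw [hrw, add_sub_cancel_left, mul_div_cancel_left₀ _ hx]
        rw [h1]
        exact (hSint _).mpr (hw i)
      have h1 : ∀ i, (c i - algebraMap R S (r i)) • (v (g i) : F) ∈ S := by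
        intro i
        obtain ⟨b, hb⟩ := hvx (g i)
        obtain ⟨s', hs'⟩ := hSt.smul_mem_of_isIntegral_div
          (P := LinearMap.range (Algebra.linearMap S F)) (n := 1) (w := (v (g i) : F)) ⟨1, by simp⟩
          ((hSint _).mpr (v (g i)).2) (by
            rw [pow_one, Algebra.smul_def]
            exact ⟨algebraMap R S b, hb.symm⟩) (by rw [pow_one]; exact hcr i)
        rw [← hs']
        exact s'.2
      have h2 : (∑ i, r i • (v (g i) : F)) ∈ S := by
        have h3 : (∑ i, r i • (v (g i) : F)) =
            s - ∑ i, (c i - algebraMap R S (r i)) • (v (g i) : F) := by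
          have h4 : ∑ i, (c i : F) * v (g i) = s := hc
          rw [← h4, ← Finset.sum_sub_distrib]
          refine Finset.sum_congr rfl fun i _ => ?_
          rw [Algebra.smul_def, Algebra.smul_def]
          change _ = _ - ((c i : F) - algebraMap R F (r i)) * _
          ring
        rw [h3]
        exact sub_mem s.2 (sum_mem fun i _ => h1 i)
      have h3 := hsupp r h2 i
      rw [hSt.not_isUnit_iff]
      have h4 : algebraMap S F (c i) / algebraMap S F (algebraMap R S x) =
          algebraMap R F (r i) / algebraMap R F x + w i := by
        change (c i : F) / algebraMap R F x = _
        rw [hrw, add_div, mul_div_cancel_left₀ _ hx]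
      rw [h4, hSint]
      exact ((h.mem_maximalIdeal_iff _).mp h3).add (hw i)
  · exact e.trans ((Ψ.submoduleMap _).symm.trans
      ((Finsupp.supportedEquivFinsupp _).trans (finsuppLEquivDirectSum R _ _)))

end IsTwistedDomain

theorem theorem4p4 {R : Type u} {F : Type v} [CommRing R] [IsBadStableDomain R]
    [Field F] [Algebra R F] [IsFractionRing R F] :
    (embDim R < ℵ₀ ↔ IsNoetherianRing R) ∧
    (∀ n : ℕ, embDim R = n →
      ∀ S : Subalgebra R F, S < integralClosure R F →
        ∃ _ : IsBadStableDomain S, IsNoetherianRing S ∧ embDim S ≤ n) ∧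
    (∀ k : ℕ, 2 ≤ k → (k : Cardinal) ≤ embDim R →
      ∃ S : Subalgebra R F, S ≤ integralClosure R F ∧
        (∃ _ : IsBadStableDomain S, IsNoetherianRing S ∧ embDim S = k) ∧
        ∃ I : Type v, Nonempty (QuotBase R S ≃ₗ[R] ⨁ _ : I, QuotNormalization R F)) := by
  obtain ⟨x, h⟩ := IsBadStableDomain.exists_isTwistedDomain R F
  refine ⟨IsBadStableDomain.isNoetherianRing_iff, fun n hn S hS => ?_, fun k hk hkR => ?_⟩
  · have := S.isFractionRing_of_isFractionRing
    have hbad := (h.of_subalgebra hS).isBadStableDomain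
    have hle : embDim S ≤ n := h.spanRank_maximalIdeal_subalgebra_le hn hS
    exact ⟨hbad, IsBadStableDomain.isNoetherianRing_iff.mp (hle.trans_lt Cardinal.natCast_lt_aleph0),
      hle⟩
  · obtain ⟨S, hS, ⟨_, hSk⟩, hI⟩ := h.exists_subalgebra_spanRank_eq hk hkR
    have := S.isFractionRing_of_isFractionRing
    have hbad := (h.of_subalgebra hS).isBadStableDomain
    have heq : embDim S = k := hSk
    exact ⟨S, hS.le, ⟨hbad, IsBadStableDomain.isNoetherianRing_iff.mp
      (heq ▸ Cardinal.natCast_lt_aleph0), heq⟩, hI⟩
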